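/- Let $X$ and $Y$ be jointly distributed random vectors in $\mathbb{R}^{d_x}$ and $\mathbb{R}^{d_y}$, $d_x,d_y\ge 1$, with an arbitrary joint law. Mutual information is $I(U;V)=D_{\mathrm{KL}}(P_{U,V}\,\|\,P_U\otimes P_V)\in[0,\infty]$, and for random vectors $U\in\mathbb{R}^{m}$, $V\in\mathbb{R}^{n}$ the sliced mutual information is $$\mathsf{SI}(U;V)=\frac{1}{S_{m-1}S_{n-1}}\oint_{\mathbb{S}^{m-1}}\oint_{\mathbb{S}^{n-1}} I(\theta^\top U;\phi^\top V)\,d\phi\,d\theta ,$$ where $S_{d-1}$ is the surface area of the unit sphere $\mathbb{S}^{d-1}\subset\mathbb{R}^d$. Let $\sigma_1(A)\ge\sigma_2(A)\ge\cdots$ be the singular values of a matrix $A$, and for $r\ge1$ and $c>0$ put $\mathcal{M}_{d_1,d_2}(r,c)=\{A\in\mathbb{R}^{d_1\times d_2}: 1/c\le\sigma_r(A)\le\dots\le\sigma_1(A)\le c\}$. 1. (Arbitrary linear processing) For all $m_x,m_y\ge 1$, with $A_x\in\mathbb{R}^{m_x\times d_x}$, $A_y\in\mathbb{R}^{m_y\times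 d_y}$, $b_x\in\mathbb{R}^{m_x}$, $b_y\in\mathbb{R}^{m_y}$, $\theta\in\mathbb{S}^{d_x-1}$ and $\phi\in\mathbb{S}^{d_y-1}$, $$\sup_{A_x,A_y,b_x,b_y}\mathsf{SI}(A_xX+b_x;A_yY+b_y)=\sup_{A_x,A_y}\mathsf{SI}(A_xX;A_yY)=\sup_{\theta,\phi} I(\theta^\top X;\phi^\top Y).$$ Furthermore, if $(\theta^\star,\phi^\star)$ maximizes $I(\theta^\top X;\phi^\top Y)$, then the suprema on the left are attained by the matrices $A_x^\star$, $A_y^\star$ (with $b_x=b_y=0$) whose first rows are $\theta^\star$, respectively $\phi^\star$, and whose other rows are zero. 2. (Rank constrained linear processing) For all $1\le r_x\le d_x$, $1\le r_y\le d_y$ and $c_x,c_y>0$, $$\sup_{\substack{A_x\in\mathcal{M}_{d_x,d_x}(r_x,c_x)\\A_y\in\mathcal{M}_{d_y,d_y}(r_y,c_y)}}\mathsf{SI}(A_xX;A_yY)=\sup_{\substack{B_x\in\mathcal{M}_{r_x,d_x}(r_x,c_x)\\B_y\in\mathcal{M}_{r_y,d_y}(r_y,c_y)}}\mathsf{SI}(B_xX;B_yY)$$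 (the supremum of the empty set being $0$). Furthermore, if $(B_x^\star,B_y^\star)$ maximizes the right-hand side, then the rows of $B_x^\star$ are linearly independent, and so are those of $B_y^\star$, and the square matrices $A_x^\star\in\mathcal{M}_{d_x,d_x}(r_x,c_x)$ and $A_y^\star\in\mathcal{M}_{d_y,d_y}(r_y,c_y)$ whose first $r_x$ (respectively $r_y$) rows are those of $B_x^\star$ (respectively $B_y^\star$), and whose remaining rows are zero, attain the supremum on the left. -/

import Mathlib

open MeasureTheory
open scoped ENNReal

/-- Mutual information `I(U;V) = D_KL(P_{U,V} ‖ P_U ⊗ P_V)` (in nats, possibly `∞`) of two real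
random variables on the probability space `(Ω, μ)`. -/
noncomputable def mutualInfo {Ω : Type*} [MeasurableSpace Ω] (μ : Measure Ω) (U V : Ω → ℝ) :
    ℝ≥0∞ :=
  InformationTheory.klDiv (μ.map (fun ω => (U ω, V ω))) ((μ.map U).prod (μ.map V))

/-- The unit sphere of `ℝ^d`. -/
abbrev UnitSphere (d : ℕ) : Type := Metric.sphere (0 : EuclideanSpace ℝ (Fin d)) 1

/-- The surface measure on the unit sphere of `ℝ^d` (the counting measure when `d = 1`). -/
noncomputable def surfaceMeasure (d : ℕ) : Measure (UnitSphere d) :=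
  (volume : Measure (EuclideanSpace ℝ (Fin d))).toSphere

/-- Mutual information `I(θᵀX;φᵀY)` of the one-dimensional projections of `X` and `Y`. -/
noncomputable def sliceInfo {Ω : Type*} [MeasurableSpace Ω] (μ : Measure Ω) {m n : ℕ}
    (X : Ω → EuclideanSpace ℝ (Fin m)) (Y : Ω → EuclideanSpace ℝ (Fin n))
    (θ : UnitSphere m) (φ : UnitSphere n) : ℝ≥0∞ :=
  mutualInfo μ (fun ω => inner ℝ (θ : EuclideanSpace ℝ (Fin m)) (X ω))
    (fun ω => inner ℝ (φ : EuclideanSpace ℝ (Fin n)) (Y ω))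

/-- Sliced mutual information: the average of `I(θᵀX;φᵀY)` over independent uniform
directions `θ`, `φ`. -/
noncomputable def slicedMI {Ω : Type*} [MeasurableSpace Ω] (μ : Measure Ω) {m n : ℕ}
    (X : Ω → EuclideanSpace ℝ (Fin m)) (Y : Ω → EuclideanSpace ℝ (Fin n)) : ℝ≥0∞ :=
  (surfaceMeasure m Set.univ * surfaceMeasure n Set.univ)⁻¹ *
    ∫⁻ θ, ∫⁻ φ, sliceInfo μ X Y θ φ ∂(surfaceMeasure n) ∂(surfaceMeasure m)

/-- The random vector `A X`. -/
noncomputable def linImage {Ω : Type*} {m d : ℕ} (A : Matrix (Fin m) (Fin d) ℝ)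
    (X : Ω → EuclideanSpace ℝ (Fin d)) : Ω → EuclideanSpace ℝ (Fin m) :=
  fun ω => Matrix.toEuclideanLin A (X ω)

/-- The random vector `A X + b`. -/
noncomputable def affineImage {Ω : Type*} {m d : ℕ} (A : Matrix (Fin m) (Fin d) ℝ)
    (b : EuclideanSpace ℝ (Fin m)) (X : Ω → EuclideanSpace ℝ (Fin d)) :
    Ω → EuclideanSpace ℝ (Fin m) :=
  fun ω => Matrix.toEuclideanLin A (X ω) + b

/-- The `m × d` matrix with first row `θ` and all other rows zero. -/
def firstRowMatrix (m : ℕ) {d : ℕ} (θ : EuclideanSpace ℝ (Fin d)) :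
    Matrix (Fin m) (Fin d) ℝ :=
  fun i j => if (i : ℕ) = 0 then θ j else 0

/-- The class of `d₁ × d₂` matrices whose `r` largest singular values lie in `[1/c, c]`.
(`LinearMap.singularValues` lists them in decreasing order with multiplicity, starting
at index `0`.) -/
def singularClass (d₁ d₂ r : ℕ) (c : ℝ) : Set (Matrix (Fin d₁) (Fin d₂) ℝ) :=
  {A | ∀ i < r, 1 / c ≤ (Matrix.toEuclideanLin A).singularValues i ∧
    (Matrix.toEuclideanLin A).singularValues i ≤ c}

/-- The `m × d` matrix whose first `r` rows are those of `B` and whose other rows are zero. -/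
def padRows (m : ℕ) {r d : ℕ} (B : Matrix (Fin r) (Fin d) ℝ) : Matrix (Fin m) (Fin d) ℝ :=
  fun i j => if h : (i : ℕ) < r then B ⟨i, h⟩ j else 0

/-!
Mutual information is invariant under invertible affine maps of either variable, so `F v w = I(vᵀX;
wᵀY)` depends only on the lines spanned by `v` and `w`, and vanishes if `v` or `w` does. Hence the
sliced mutual information of `AX + a` and `BY + b` is the mean of `F (Aᵀg) (Bᵀh)` over independent
standard Gaussian vectors `g`, `h` (`slicedMI_affineImage`): the direction of a Gaussian is uniform
on the sphere.

For arbitrary linear processing, a mean of values of `F` is at most their supremum. For the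
matrices with a single nonzero row `θ` one has `Aᵀg = g₀ θ` with `g₀ ≠ 0` almost surely, so the
sliced information equals `I(θᵀX; φᵀY)` (`slicedMI_firstRowMatrix`).

For rank constrained processing, appending zero rows changes neither the Gram matrix nor the law of
`Aᵀg`, which gives one inequality and the attainment. The converse inequality is a statement about
Gaussian means of functions of the direction (`lintegral_stdGaussian_linear_le`): the direction of
`Aᵀg`, where `Aᵀ` has norm at most `c` and is bounded below by `1/c` on an `r`-dimensional
subspace, is a mixture of directions of `Bᵀg'`, where `g'` is an `r`-dimensional Gaussian and `Bᵀ`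
satisfies both bounds everywhere. The singular values of `A` beyond the `r`-th need not vanish, so
`A` cannot simply be truncated. The dimension is lowered one at a time, and the key step
(`lintegral_axisScale_le`) says that the direction of a Gaussian flattened along a unit vector `e`
by a factor `s ≤ 1` is a mixture of uniform directions in hyperplanes. To see this, write the
density of the flattened Gaussian as a radial function times `exp (c p ^ 2)`, where `p` is the
distance to the axis of `e` and `c ≥ 0`, and expand the exponential. It remains to treat a weight
`p ^ (2 k)`. Up to a constant and a radial factor, `p ^ (2 k)` at `y` is the mean of `⟪e, n⟫ ^ (2
k)` over Gaussian vectors `n` in the hyperplane orthogonal to `y`. Exchanging the roles of `y` and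
`n`, which are related by a random rotation (Haar measure on the orthogonal group), this weight
distributes the direction of `y` uniformly in the hyperplane orthogonal to `n`, where `n` carries
the weight `⟪e, n⟫ ^ (2 k)`.
-/

open ProbabilityTheory Module
open scoped RealInnerProductSpace

/-! ### Mutual information of one-dimensional projections -/

/-- Joint measurability of the Radon–Nikodym derivative of a kernel makes the divergence
measurable in the parameter. -/
theorem measurable_klDiv_kernel {α β : Type*} [MeasurableSpace α] [MeasurableSpace β]
    [MeasurableSpace.CountableOrCountablyGenerated α β]
    (κ η : Kernel α β) [IsFiniteKernel κ] [IsFiniteKernel η] :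
    Measurable fun a => InformationTheory.klDiv (κ a) (η a) := by
  classical
  have h : ∀ a, InformationTheory.klDiv (κ a) (η a) =
      if κ a ≪ η a then
        ∫⁻ b, ENNReal.ofReal (InformationTheory.klFun (Kernel.rnDeriv κ η a b).toReal) ∂(η a)
      else ∞ := by
    intro a
    rw [InformationTheory.klDiv_eq_lintegral_klFun]
    split_ifs with hac
    · refine lintegral_congr_ae ?_
      filter_upwards [Kernel.rnDeriv_eq_rnDeriv_measure (κ := κ) (η := η) (a := a)] with b hb
      rw [hb]
    · rfl
  simp_rw [h]
  refine Measurable.ite (Kernel.measurableSet_absolutelyContinuous κ η) ?_ measurable_const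
  refine Measurable.lintegral_kernel_prod_right (κ := η) ?_
  exact (InformationTheory.measurable_klFun.comp
    (Kernel.measurable_rnDeriv κ η).ennreal_toReal).ennreal_ofReal

section MutualInfo

variable {Ω : Type*} [MeasurableSpace Ω] (μ : Measure Ω) [IsProbabilityMeasure μ]

theorem mutualInfo_comp_le {U V : Ω → ℝ} (hU : Measurable U) (hV : Measurable V)
    {f g : ℝ → ℝ} (hf : Measurable f) (hg : Measurable g) :
    mutualInfo μ (f ∘ U) (g ∘ V) ≤ mutualInfo μ U V := by
  have : IsProbabilityMeasure (μ.map U) := Measure.isProbabilityMeasure_map hU.aemeasurable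
  have : IsProbabilityMeasure (μ.map V) := Measure.isProbabilityMeasure_map hV.aemeasurable
  have : IsProbabilityMeasure (μ.map fun ω => (U ω, V ω)) :=
    Measure.isProbabilityMeasure_map (hU.prodMk hV).aemeasurable
  unfold mutualInfo
  have h1 : μ.map (fun ω => ((f ∘ U) ω, (g ∘ V) ω)) =
      (μ.map fun ω => (U ω, V ω)).map (Prod.map f g) := by
    rw [Measure.map_map (hf.prodMap hg) (hU.prodMk hV)]; rfl
  have h2 : (μ.map (f ∘ U)).prod (μ.map (g ∘ V)) =
      ((μ.map U).prod (μ.map V)).map (Prod.map f g) := by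
    rw [← Measure.map_map hf hU, ← Measure.map_map hg hV, Measure.map_prod_map _ _ hf hg]
  rw [h1, h2]
  exact InformationTheory.klDiv_map_le _ _ (hf.prodMap hg)

/-- Mutual information is invariant under invertible affine changes of either variable. -/
theorem mutualInfo_affine {U V : Ω → ℝ} (hU : Measurable U) (hV : Measurable V)
    {a b : ℝ} (ha : a ≠ 0) (hb : b ≠ 0) (s t : ℝ) :
    mutualInfo μ (fun ω => a * U ω + s) (fun ω => b * V ω + t) = mutualInfo μ U V := by
  refine le_antisymm ?_ ?_
  · exact mutualInfo_comp_le μ hU hV (f := fun x => a * x + s) (g := fun x => b * x + t)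
      (by fun_prop) (by fun_prop)
  · have h := mutualInfo_comp_le μ (U := fun ω => a * U ω + s) (V := fun ω => b * V ω + t)
      (by fun_prop) (by fun_prop)
      (f := fun x => a⁻¹ * (x - s)) (g := fun x => b⁻¹ * (x - t)) (by fun_prop) (by fun_prop)
    convert h using 2 <;> ext ω <;> simp [ha, hb]

theorem mutualInfo_const_left {V : Ω → ℝ} (hV : Measurable V) (c : ℝ) :
    mutualInfo μ (fun _ => c) V = 0 := by
  have : IsProbabilityMeasure (μ.map V) := Measure.isProbabilityMeasure_map hV.aemeasurable
  unfold mutualInfo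
  have h : μ.map (fun ω => (c, V ω)) = (μ.map (fun _ : Ω => c)).prod (μ.map V) := by
    rw [Measure.map_const, measure_univ, one_smul, Measure.dirac_prod,
      Measure.map_map (by fun_prop) hV]
    rfl
  rw [h, InformationTheory.klDiv_self]

theorem mutualInfo_const_right {U : Ω → ℝ} (hU : Measurable U) (c : ℝ) :
    mutualInfo μ U (fun _ => c) = 0 := by
  have : IsProbabilityMeasure (μ.map U) := Measure.isProbabilityMeasure_map hU.aemeasurable
  unfold mutualInfo
  have h : μ.map (fun ω => (U ω, c)) = (μ.map U).prod (μ.map (fun _ : Ω => c)) := by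
    rw [Measure.map_const, measure_univ, one_smul, Measure.prod_dirac,
      Measure.map_map (by fun_prop) hU]
    rfl
  rw [h, InformationTheory.klDiv_self]

variable {m n : ℕ}

/-- The mutual information `I(vᵀX; wᵀY)` as a function of arbitrary vectors `v`, `w`. -/
noncomputable def projInfo (X : Ω → EuclideanSpace ℝ (Fin m)) (Y : Ω → EuclideanSpace ℝ (Fin n))
    (v : EuclideanSpace ℝ (Fin m)) (w : EuclideanSpace ℝ (Fin n)) : ℝ≥0∞ :=
  mutualInfo μ (fun ω => inner ℝ v (X ω)) (fun ω => inner ℝ w (Y ω))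

variable {X : Ω → EuclideanSpace ℝ (Fin m)} {Y : Ω → EuclideanSpace ℝ (Fin n)}

theorem projInfo_smul (hX : Measurable X) (hY : Measurable Y) {a b : ℝ} (ha : a ≠ 0) (hb : b ≠ 0)
    (v : EuclideanSpace ℝ (Fin m)) (w : EuclideanSpace ℝ (Fin n)) :
    projInfo μ X Y (a • v) (b • w) = projInfo μ X Y v w := by
  have := mutualInfo_affine μ (U := fun ω => inner ℝ v (X ω)) (V := fun ω => inner ℝ w (Y ω))
    (by fun_prop) (by fun_prop) ha hb 0 0
  simpa [projInfo, real_inner_smul_left] using this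

theorem projInfo_zero_left (hY : Measurable Y) (w : EuclideanSpace ℝ (Fin n)) :
    projInfo μ X Y 0 w = 0 := by
  simpa [projInfo] using mutualInfo_const_left μ (V := fun ω => inner ℝ w (Y ω)) (by fun_prop) 0

theorem projInfo_zero_right (hX : Measurable X) (v : EuclideanSpace ℝ (Fin m)) :
    projInfo μ X Y v 0 = 0 := by
  simpa [projInfo] using mutualInfo_const_right μ (U := fun ω => inner ℝ v (X ω)) (by fun_prop) 0

/-- `I(vᵀX; wᵀY)` is jointly measurable in `(v, w)`, so that Tonelli applies to all the averages
of this function; the joint law and the marginals are kernels in `(v, w)`. -/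
theorem measurable_projInfo (hX : Measurable X) (hY : Measurable Y) :
    Measurable fun p : EuclideanSpace ℝ (Fin m) × EuclideanSpace ℝ (Fin n) =>
      projInfo μ X Y p.1 p.2 := by
  let f : (EuclideanSpace ℝ (Fin m) × EuclideanSpace ℝ (Fin n)) × Ω → ℝ × ℝ :=
    fun q => (inner ℝ q.1.1 (X q.2), inner ℝ q.1.2 (Y q.2))
  have hf : Measurable f := by
    have h1 : Measurable fun q : (EuclideanSpace ℝ (Fin m) × EuclideanSpace ℝ (Fin n)) × Ω =>
      X q.2 := hX.comp measurable_snd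
    have h2 : Measurable fun q : (EuclideanSpace ℝ (Fin m) × EuclideanSpace ℝ (Fin n)) × Ω =>
      Y q.2 := hY.comp measurable_snd
    exact (measurable_fst.fst.inner h1).prodMk (measurable_fst.snd.inner h2)
  let κ : Kernel (EuclideanSpace ℝ (Fin m) × EuclideanSpace ℝ (Fin n)) (ℝ × ℝ) :=
    (Kernel.prod Kernel.id (Kernel.const _ μ)).map f
  have hκ : ∀ p, κ p = μ.map fun ω => f (p, ω) := by
    intro p
    rw [Kernel.map_apply _ hf, Kernel.prod_apply, Kernel.id_apply, Kernel.const_apply,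
      Measure.dirac_prod, Measure.map_map hf (by fun_prop)]
    rfl
  have : IsMarkovKernel κ := Kernel.IsMarkovKernel.map _ hf
  have hfst : IsMarkovKernel (κ.map Prod.fst) := Kernel.IsMarkovKernel.map _ measurable_fst
  have hsnd : IsMarkovKernel (κ.map Prod.snd) := Kernel.IsMarkovKernel.map _ measurable_snd
  have hm := measurable_klDiv_kernel κ ((κ.map Prod.fst).prod (κ.map Prod.snd))
  convert hm using 2 with p
  rw [Kernel.prod_apply, Kernel.map_apply _ measurable_fst, Kernel.map_apply _ measurable_snd, hκ,
    Measure.map_map measurable_fst (by fun_prop), Measure.map_map measurable_snd (by fun_prop)]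
  rfl

end MutualInfo

/-! ### Gaussian and spherical means of directional functions -/

section Gaussian

variable {E : Type*} [NormedAddCommGroup E] [InnerProductSpace ℝ E] [FiniteDimensional ℝ E]
  [MeasurableSpace E] [BorelSpace E]
variable {F : Type*} [NormedAddCommGroup F] [InnerProductSpace ℝ F] [FiniteDimensional ℝ F]
  [MeasurableSpace F] [BorelSpace F]

variable (E) in
/-- The density of the standard Gaussian, obtained by comparing characteristic functions. -/
theorem stdGaussian_eq_withDensity :
    stdGaussian E = (volume : Measure E).withDensity fun x =>
      ENNReal.ofReal ((2 * Real.pi) ^ (-(finrank ℝ E / 2 : ℝ)) * Real.exp (-(‖x‖ ^ 2 / 2))) := by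
  have hint : Integrable fun x : E => Real.exp (-(‖x‖ ^ 2 / 2)) := by
    have h := (GaussianFourier.integrable_cexp_neg_mul_sq_norm_add (V := E) (b := 1 / 2)
      (by norm_num) 0 0).re
    refine h.congr (Filter.Eventually.of_forall fun x => ?_)
    have h2 : (-(1 / 2 : ℂ) * ‖x‖ ^ 2 + 0 * (inner ℝ (0 : E) x : ℝ)) =
        ((-(‖x‖ ^ 2 / 2) : ℝ) : ℂ) := by
      push_cast; ring
    simp only [h2]
    exact Complex.exp_ofReal_re _
  have hfin : IsFiniteMeasure ((volume : Measure E).withDensity fun x =>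
      ENNReal.ofReal ((2 * Real.pi) ^ (-(finrank ℝ E / 2 : ℝ)) * Real.exp (-(‖x‖ ^ 2 / 2)))) :=
    isFiniteMeasure_withDensity_ofReal (hint.const_mul _).2
  refine Measure.ext_of_charFun ?_
  ext t
  rw [charFun_stdGaussian, charFun_apply,
    integral_withDensity_eq_integral_toReal_smul (by fun_prop) (by simp)]
  have h := GaussianFourier.integral_cexp_neg_mul_sq_norm_add (V := E) (b := 1 / 2)
    (by norm_num) Complex.I t
  have h3 : ∀ x : E, (ENNReal.ofReal ((2 * Real.pi) ^ (-(finrank ℝ E / 2 : ℝ)) *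
      Real.exp (-(‖x‖ ^ 2 / 2)))).toReal • Complex.exp ((inner ℝ x t : ℝ) * Complex.I) =
      ((2 * Real.pi : ℝ) ^ (-(finrank ℝ E / 2 : ℝ)) : ℝ) *
        Complex.exp (-(1 / 2 : ℂ) * ‖x‖ ^ 2 + Complex.I * (inner ℝ t x : ℝ)) := by
    intro x
    rw [ENNReal.toReal_ofReal (by positivity), Complex.real_smul, Complex.ofReal_mul,
      Complex.ofReal_exp, mul_assoc, ← Complex.exp_add, real_inner_comm]
    congr 2
    push_cast; ring
  simp_rw [h3]
  rw [integral_const_mul, h]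
  have h4 : ((Real.pi : ℂ) / (1 / 2)) ^ ((finrank ℝ E : ℂ) / 2) =
      (((2 * Real.pi : ℝ) ^ ((finrank ℝ E : ℝ) / 2) : ℝ) : ℂ) := by
    rw [Complex.ofReal_cpow (by positivity)]
    push_cast
    congr 1; ring
  rw [h4, ← mul_assoc, ← Complex.ofReal_mul, ← Real.rpow_add (by positivity)]
  simp only [neg_add_cancel, Real.rpow_zero, Complex.ofReal_one, one_mul, Complex.I_sq]
  congr 1; ring

variable (E) in
/-- Integration against the standard Gaussian, with the normalizing constant left implicit: only
its being finite and nonzero matters. -/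
theorem exists_lintegral_stdGaussian : ∃ C : ℝ≥0∞, C ≠ 0 ∧ C ≠ ∞ ∧
    ∀ f : E → ℝ≥0∞, Measurable f → ∫⁻ x, f x ∂stdGaussian E =
      C * ∫⁻ x, ENNReal.ofReal (Real.exp (-(‖x‖ ^ 2 / 2))) * f x := by
  refine ⟨ENNReal.ofReal ((2 * Real.pi) ^ (-(finrank ℝ E / 2 : ℝ))), ?_, ENNReal.ofReal_ne_top,
    fun f hf => ?_⟩
  · simp only [ne_eq, ENNReal.ofReal_eq_zero, not_le]; positivity
  · rw [stdGaussian_eq_withDensity, lintegral_withDensity_eq_lintegral_mul _ (by fun_prop) hf,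
      ← lintegral_const_mul _ (by fun_prop)]
    refine lintegral_congr fun x => ?_
    rw [Pi.mul_apply, ENNReal.ofReal_mul (by positivity), mul_assoc]

/-- The orthogonal projection of a standard Gaussian is a standard Gaussian. -/
theorem stdGaussian_map_adjoint (W : F →ₗᵢ[ℝ] E) :
    (stdGaussian E).map (LinearMap.adjoint W.toLinearMap) = stdGaussian F := by
  have hm : Measurable (LinearMap.adjoint W.toLinearMap) :=
    (LinearMap.continuous_of_finiteDimensional _).measurable
  have := Measure.isProbabilityMeasure_map (μ := stdGaussian E) hm.aemeasurable
  refine Measure.ext_of_charFun ?_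
  ext t
  rw [charFun_apply, integral_map hm.aemeasurable (by fun_prop)]
  simp_rw [LinearMap.adjoint_inner_left]
  have := charFun_stdGaussian (E := E) (W t)
  rw [charFun_apply] at this
  rw [charFun_stdGaussian]
  simpa using this

/-- A function on a vector space that depends only on the line spanned by its argument
(with an arbitrary value at `0`). -/
def IsDirectional {V : Type*} [AddCommGroup V] [Module ℝ V] (f : V → ℝ≥0∞) : Prop :=
  ∀ t : ℝ, t ≠ 0 → ∀ x, f (t • x) = f x

theorem IsDirectional.comp_linear {V W : Type*} [AddCommGroup V] [Module ℝ V] [AddCommGroup W]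
    [Module ℝ W] {f : W → ℝ≥0∞} (hf : IsDirectional f) (L : V →ₗ[ℝ] W) :
    IsDirectional fun x => f (L x) := fun t ht x => by
    simp only [map_smul, hf t ht]

/-- Integration in polar coordinates. -/
theorem lintegral_polar [Nontrivial E] (f : E → ℝ≥0∞) (hf : Measurable f) :
    ∫⁻ x, f x = ∫⁻ θ : Metric.sphere (0 : E) 1, ∫⁻ r : Set.Ioi (0 : ℝ), f (r.1 • θ.1)
      ∂(Measure.volumeIoiPow (finrank ℝ E - 1)) ∂((volume : Measure E).toSphere) := by
  have h1 : ∫⁻ x, f x = ∫⁻ x : ({0}ᶜ : Set E), f x ∂((volume : Measure E).comap Subtype.val) := by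
    rw [lintegral_subtype_comap (measurableSet_singleton 0).compl,
      restrict_compl_singleton]
  have hmp := (volume : Measure E).measurePreserving_homeomorphUnitSphereProd
  have hmp' := hmp.symm (homeomorphUnitSphereProd E).toMeasurableEquiv
  rw [h1, ← hmp'.lintegral_comp (by fun_prop), lintegral_prod]
  · rfl
  · exact Measurable.aemeasurable (hf.comp (measurable_subtype_coe.comp hmp'.measurable))

/-- The spherical mean of a directional function is its Gaussian mean. -/
theorem lintegral_toSphere_eq_stdGaussian [Nontrivial E] {f : E → ℝ≥0∞} (hf : Measurable f)
    (hdir : IsDirectional f) :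
    ((volume : Measure E).toSphere Set.univ)⁻¹ *
      ∫⁻ θ : Metric.sphere (0 : E) 1, f θ ∂((volume : Measure E).toSphere) =
    ∫⁻ x, f x ∂stdGaussian E := by
  obtain ⟨C, hC0, hCt, hC⟩ := exists_lintegral_stdGaussian E
  set R : ℝ≥0∞ := ∫⁻ r : Set.Ioi (0 : ℝ), ENNReal.ofReal (Real.exp (-(r.1 ^ 2 / 2)))
    ∂(Measure.volumeIoiPow (finrank ℝ E - 1))
  have key : ∀ g : E → ℝ≥0∞, Measurable g → IsDirectional g →
      ∫⁻ x, g x ∂stdGaussian E =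
        C * R * ∫⁻ θ : Metric.sphere (0 : E) 1, g θ ∂((volume : Measure E).toSphere) := by
    intro g hg hgd
    rw [hC g hg, lintegral_polar _ (by fun_prop), mul_assoc,
      ← lintegral_const_mul R (by fun_prop)]
    congr 1
    refine lintegral_congr fun θ => ?_
    rw [← lintegral_mul_const _ (by fun_prop)]
    refine lintegral_congr fun r => ?_
    have hr : ‖r.1 • θ.1‖ = r.1 := by
      rw [norm_smul, Real.norm_of_nonneg (le_of_lt r.2)]
      simp
    rw [hr, hgd _ (ne_of_gt r.2)]
  have h1 := key (fun _ => 1) measurable_const (fun _ _ _ => rfl)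
  simp only [lintegral_const, measure_univ, mul_one, one_mul] at h1
  rw [key f hf hdir, ENNReal.eq_inv_of_mul_eq_one_left h1.symm]

end Gaussian

/-! ### The orthogonal group and Gaussian moments -/

section Orthogonal

variable {E : Type*} [NormedAddCommGroup E] [InnerProductSpace ℝ E]

/-- The orthogonal group acts transitively on orthogonal pairs of given lengths: compose two
reflections. -/
theorem exists_linearIsometryEquiv_map_pair {a₁ a₂ b₁ b₂ : E} (h₁ : ‖a₁‖ = ‖b₁‖)
    (h₂ : ‖a₂‖ = ‖b₂‖) (ha : ⟪a₁, a₂⟫ = 0) (hb : ⟪b₁, b₂⟫ = 0) :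
    ∃ R : E ≃ₗᵢ[ℝ] E, R a₁ = b₁ ∧ R a₂ = b₂ := by
  set S := (ℝ ∙ (a₁ - b₁))ᗮ.reflection
  have hS : S a₁ = b₁ := Submodule.reflection_sub h₁
  have hS2 : ⟪b₁, S a₂⟫ = 0 := by rw [← hS, S.inner_map_map, ha]
  set T := (ℝ ∙ (S a₂ - b₂))ᗮ.reflection
  have hT : T (S a₂) = b₂ := Submodule.reflection_sub (by rw [S.norm_map, h₂])
  have hT1 : T b₁ = b₁ := by
    refine Submodule.reflection_mem_subspace_eq_self ?_
    rw [Submodule.mem_orthogonal_singleton_iff_inner_left, inner_sub_right, hS2, hb, sub_zero]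
  exact ⟨S.trans T, by simp [hS, hT1], by simp [hT]⟩

section Complete

variable [CompleteSpace E]

theorem unitary_norm_map (O : unitary (E →L[ℝ] E)) (x : E) : ‖(O : E →L[ℝ] E) x‖ = ‖x‖ :=
  (Unitary.linearIsometryEquiv O).norm_map x

theorem unitary_inner_map_map (O : unitary (E →L[ℝ] E)) (x y : E) :
    ⟪(O : E →L[ℝ] E) x, (O : E →L[ℝ] E) y⟫ = ⟪x, y⟫ :=
  (Unitary.linearIsometryEquiv O).inner_map_map x y

theorem exists_unitary_map_pair {a₁ a₂ b₁ b₂ : E} (h₁ : ‖a₁‖ = ‖b₁‖)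
    (h₂ : ‖a₂‖ = ‖b₂‖) (ha : ⟪a₁, a₂⟫ = 0) (hb : ⟪b₁, b₂⟫ = 0) :
    ∃ R : unitary (E →L[ℝ] E), (R : E →L[ℝ] E) a₁ = b₁ ∧ (R : E →L[ℝ] E) a₂ = b₂ := by
  obtain ⟨R, h⟩ := exists_linearIsometryEquiv_map_pair h₁ h₂ ha hb
  exact ⟨Unitary.linearIsometryEquiv.symm R, h⟩

end Complete

variable [FiniteDimensional ℝ E]

/-- An isometric parametrization of the hyperplane orthogonal to `y`. -/
theorem exists_linearIsometry_onto_orthogonal {m : ℕ} (hm : finrank ℝ E = m + 1) {y : E}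
    (hy : y ≠ 0) :
    ∃ W : EuclideanSpace ℝ (Fin m) →ₗᵢ[ℝ] E,
      (∀ x, ⟪y, W x⟫ = 0) ∧ ∀ z, ⟪y, z⟫ = 0 → ∃ x, W x = z := by
  have : Fact (finrank ℝ E = m + 1) := ⟨hm⟩
  have hf : finrank ℝ (ℝ ∙ y)ᗮ = m := Submodule.finrank_orthogonal_span_singleton hy
  let b := (stdOrthonormalBasis ℝ (ℝ ∙ y)ᗮ).reindex (finCongr hf)
  refine ⟨(ℝ ∙ y)ᗮ.subtypeₗᵢ.comp b.repr.symm.toLinearIsometry, fun x => ?_, fun z hz => ?_⟩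
  · have := (b.repr.symm x).2
    rwa [Submodule.mem_orthogonal_singleton_iff_inner_right] at this
  · refine ⟨b.repr ⟨z, ?_⟩, by simp⟩
    rwa [Submodule.mem_orthogonal_singleton_iff_inner_right]

/-- Pythagoras for the projection of `z` onto the hyperplane orthogonal to `y`. -/
theorem norm_sq_mul_norm_adjoint_sq {m : ℕ} {y : E} (hy : y ≠ 0)
    (W : EuclideanSpace ℝ (Fin m) →ₗᵢ[ℝ] E) (hW : ∀ x, ⟪y, W x⟫ = 0)
    (hW' : ∀ z, ⟪y, z⟫ = 0 → ∃ x, W x = z) (z : E) :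
    ‖y‖ ^ 2 * ‖LinearMap.adjoint W.toLinearMap z‖ ^ 2 = ‖y‖ ^ 2 * ‖z‖ ^ 2 - ⟪y, z⟫ ^ 2 := by
  have hy2 : ‖y‖ ^ 2 ≠ 0 := by simpa using hy
  obtain ⟨x, hx⟩ := hW' (z - (⟪y, z⟫ / ‖y‖ ^ 2) • y) (by
    rw [inner_sub_right, real_inner_smul_right, real_inner_self_eq_norm_sq,
      div_mul_cancel₀ _ hy2, sub_self])
  have hz : z = W x + (⟪y, z⟫ / ‖y‖ ^ 2) • y := by rw [hx]; abel
  have hxz : LinearMap.adjoint W.toLinearMap z = x := by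
    refine ext_inner_right ℝ fun v => ?_
    rw [LinearMap.adjoint_inner_left]
    conv_lhs => rw [hz]
    simp [inner_add_left, real_inner_smul_left, hW]
  have hWy : ⟪W x, y⟫ = 0 := by rw [real_inner_comm]; exact hW x
  have hn : ‖z‖ ^ 2 = ‖x‖ ^ 2 + (⟪y, z⟫ / ‖y‖ ^ 2) ^ 2 * ‖y‖ ^ 2 := by
    conv_lhs => rw [hz, norm_add_sq_real]
    rw [real_inner_smul_right, hWy, norm_smul, W.norm_map, mul_pow,
      Real.norm_eq_abs, sq_abs]
    ring
  rw [hxz, hn]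
  field_simp
  ring

variable [CompleteSpace E]

instance compactSpace_unitary : CompactSpace (unitary (E →L[ℝ] E)) := by
  refine isCompact_iff_compactSpace.1
    (show IsCompact (unitary (E →L[ℝ] E) : Set (E →L[ℝ] E)) from ?_)
  refine Metric.isCompact_of_isClosed_isBounded isClosed_unitary ?_
  refine (Metric.isBounded_closedBall (x := (0 : E →L[ℝ] E)) (r := 1)).subset fun u hu => ?_
  rw [mem_closedBall_zero_iff]
  refine ContinuousLinearMap.opNorm_le_bound _ zero_le_one fun x => ?_
  have := (Unitary.linearIsometryEquiv ⟨u, hu⟩).norm_map x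
  rw [one_mul, ← this]
  rfl

variable (E) in
/-- The orthogonal group carries a right-invariant probability measure. -/
theorem exists_rightInvariant_unitary : ∃ ν : Measure (unitary (E →L[ℝ] E)),
    IsProbabilityMeasure ν ∧ ν.IsMulRightInvariant := by
  let ν₀ : Measure (unitary (E →L[ℝ] E)) := Measure.haarMeasure ⊤
  have h0 : ν₀ Set.univ = 1 := Measure.haarMeasure_self (K₀ := ⊤)
  refine ⟨ν₀.inv, ⟨?_⟩, inferInstance⟩
  rw [Measure.inv_apply, Set.inv_univ, h0]

variable [MeasurableSpace E] [BorelSpace E]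

theorem measurable_unitary_apply :
    Measurable fun p : unitary (E →L[ℝ] E) × E => (p.1 : E →L[ℝ] E) p.2 := by
  refine Continuous.measurable ?_
  exact (continuous_subtype_val.comp continuous_fst).clm_apply continuous_snd

end Orthogonal

section Moments

theorem ae_ne_zero_stdGaussian {m : ℕ} (hm : 1 ≤ m) :
    ∀ᵐ x ∂stdGaussian (EuclideanSpace ℝ (Fin m)), x ≠ 0 := by
  have : Nonempty (Fin m) := ⟨⟨0, hm⟩⟩
  rw [stdGaussian_eq_withDensity]
  refine (withDensity_absolutelyContinuous _ _).ae_le ?_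
  exact compl_mem_ae_iff.2 (measure_singleton 0)

theorem map_inner_stdGaussian {m : ℕ} {a : EuclideanSpace ℝ (Fin m)} (ha : ‖a‖ = 1) :
    (stdGaussian (EuclideanSpace ℝ (Fin m))).map (fun x => ⟪a, x⟫) = gaussianReal 0 1 := by
  have h := IsGaussian.map_eq_gaussianReal (μ := stdGaussian (EuclideanSpace ℝ (Fin m)))
    (innerSL ℝ a)
  rw [integral_strongDual_stdGaussian, variance_dual_stdGaussian, innerSL_apply_norm, ha] at h
  norm_num at h
  exact h

/-- Even moments of a linear form under the standard Gaussian. -/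
theorem exists_moment_stdGaussian (m k : ℕ) :
    ∃ C : ℝ≥0∞, C ≠ 0 ∧ C ≠ ∞ ∧ ∀ a : EuclideanSpace ℝ (Fin m),
      ∫⁻ x, ‖(⟪a, x⟫ : ℝ)‖ₑ ^ (2 * k) ∂stdGaussian (EuclideanSpace ℝ (Fin m)) =
        C * ‖a‖ₑ ^ (2 * k) := by
  have hone : ∀ (a : EuclideanSpace ℝ (Fin m)), ‖a‖ = 1 →
      ∫⁻ x, ‖(⟪a, x⟫ : ℝ)‖ₑ ^ (2 * k) ∂stdGaussian (EuclideanSpace ℝ (Fin m)) =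
        ∫⁻ t, ‖t‖ₑ ^ (2 * k) ∂gaussianReal 0 1 := by
    intro a ha
    rw [← map_inner_stdGaussian ha, lintegral_map (by fun_prop) (by fun_prop)]
  refine ⟨∫⁻ t, ‖t‖ₑ ^ (2 * k) ∂gaussianReal 0 1, ?_, ?_, fun a => ?_⟩
  · rw [ne_eq, lintegral_eq_zero_iff (by fun_prop)]
    intro h
    have h1 : ∀ᵐ t ∂gaussianReal 0 1, t = 0 := by
      filter_upwards [h] with t ht
      by_contra h0
      exact pow_ne_zero _ (by simpa using h0) ht
    have := nullSingletonClass_gaussianReal (μ := 0) (v := 1) one_ne_zero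
    have h2 : ∀ᵐ t ∂gaussianReal 0 1, t ≠ (0 : ℝ) := by
      rw [ae_iff]; simp
    obtain ⟨t, ht1, ht2⟩ := (h1.and h2).exists
    exact ht2 ht1
  · have h := memLp_id_gaussianReal (μ := 0) (v := 1) (2 * k : ℕ)
    rcases Nat.eq_zero_or_pos k with rfl | hk
    · simp
    have h2 := lintegral_rpow_enorm_lt_top_of_eLpNorm_lt_top (by positivity)
      ENNReal.coe_ne_top h.2
    have h3 : (((2 * k : ℕ) : NNReal) : ℝ≥0∞).toReal = ((2 * k : ℕ) : ℝ) := by simp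
    simp only [h3, ENNReal.rpow_natCast] at h2
    exact h2.ne
  · rcases eq_or_ne a 0 with rfl | ha
    · rcases Nat.eq_zero_or_pos k with rfl | hk
      · simp
      · simp [hk.ne']
    · have hn : ‖a‖ ≠ 0 := by simpa using ha
      rw [← hone (‖a‖⁻¹ • a) (by simp [norm_smul, hn]), ← lintegral_mul_const _ (by fun_prop)]
      refine lintegral_congr fun x => ?_
      rw [← mul_pow, ← enorm_norm a, ← enorm_mul, real_inner_smul_left]
      congr 2
      field_simp

end Moments

/-! ### Averages over random rotations -/

section Averaging

variable {E : Type*} [NormedAddCommGroup E] [InnerProductSpace ℝ E] [FiniteDimensional ℝ E]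
  [CompleteSpace E]

/-- The Gaussian moments of the linear form `x ↦ ⟪e, O x⟫` on the hyperplane orthogonal to `y`,
parametrized by `W`, recover the component of `O y` orthogonal to `e`: both are, up to the factor
`‖y‖`, the distance between `e` and the line of `O y`. -/
theorem moment_hyperplane {m : ℕ} {k : ℕ} {C : ℝ≥0∞}
    (hC : ∀ a : EuclideanSpace ℝ (Fin m),
      ∫⁻ x, ‖⟪a, x⟫‖ₑ ^ (2 * k) ∂stdGaussian (EuclideanSpace ℝ (Fin m)) = C * ‖a‖ₑ ^ (2 * k))
    {e : E} (he : ‖e‖ = 1) {y : E} (hy : y ≠ 0) (W : EuclideanSpace ℝ (Fin m) →ₗᵢ[ℝ] E)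
    (hW : ∀ x, ⟪y, W x⟫ = 0) (hW' : ∀ z, ⟪y, z⟫ = 0 → ∃ x, W x = z)
    (O : unitary (E →L[ℝ] E)) :
    C * ‖(O : E →L[ℝ] E) y - ⟪e, (O : E →L[ℝ] E) y⟫ • e‖ₑ ^ (2 * k) =
      ‖y‖ₑ ^ (2 * k) * ∫⁻ x, ‖⟪e, (O : E →L[ℝ] E) (W x)⟫‖ₑ ^ (2 * k)
        ∂stdGaussian (EuclideanSpace ℝ (Fin m)) := by
  obtain ⟨z, hz⟩ := (Unitary.linearIsometryEquiv O).surjective e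
  replace hz : (O : E →L[ℝ] E) z = e := hz
  have hz1 : ‖z‖ = 1 := by rw [← unitary_norm_map O, hz, he]
  have h1 : ∀ x, ⟪e, (O : E →L[ℝ] E) (W x)⟫ = ⟪LinearMap.adjoint W.toLinearMap z, x⟫ := by
    intro x
    rw [LinearMap.adjoint_inner_left, ← hz, unitary_inner_map_map]
    rfl
  have h2 : ‖y‖ * ‖LinearMap.adjoint W.toLinearMap z‖ =
      ‖(O : E →L[ℝ] E) y - ⟪e, (O : E →L[ℝ] E) y⟫ • e‖ := by
    rw [← sq_eq_sq₀ (by positivity) (by positivity), mul_pow,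
      norm_sq_mul_norm_adjoint_sq hy W hW hW', norm_sub_sq_real, unitary_norm_map, hz1,
      norm_smul, he, real_inner_smul_right, real_inner_comm e]
    rw [← hz, unitary_inner_map_map, mul_one, Real.norm_eq_abs, sq_abs, real_inner_comm]
    ring
  simp_rw [h1]
  rw [hC, ← enorm_norm (_ - _), ← h2, enorm_mul, enorm_norm, enorm_norm, mul_pow]
  ring

variable [MeasurableSpace E] [BorelSpace E]
  (ν : Measure (unitary (E →L[ℝ] E))) [IsProbabilityMeasure ν]

/-- For a random rotation `O` and `u ⊥ v`, given `O v` the direction of `O u` is uniform in the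
hyperplane orthogonal to `O v`. So a bound `M` for the means of `H` over hyperplanes persists under
any weight that depends on `O v` only. -/
theorem lintegral_unitary_pair_le [ν.IsMulRightInvariant] {m : ℕ}
    (hm : finrank ℝ E = m + 1) (hm1 : 1 ≤ m)
    {H : E → ℝ≥0∞} (hH : Measurable H) (hd : IsDirectional H) {M : ℝ≥0∞}
    (hM : ∀ W : EuclideanSpace ℝ (Fin m) →ₗᵢ[ℝ] E,
      ∫⁻ x, H (W x) ∂stdGaussian (EuclideanSpace ℝ (Fin m)) ≤ M)
    (e : E) (k : ℕ) {u v : E} (hu : u ≠ 0) (hv : v ≠ 0) (huv : ⟪u, v⟫ = 0) :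
    ∫⁻ O, H ((O : E →L[ℝ] E) u) * ‖⟪e, (O : E →L[ℝ] E) v⟫‖ₑ ^ (2 * k) ∂ν ≤
      M * ∫⁻ O, ‖⟪e, (O : E →L[ℝ] E) v⟫‖ₑ ^ (2 * k) ∂ν := by
  obtain ⟨W, hW, -⟩ := exists_linearIsometry_onto_orthogonal hm hv
  have hap : ∀ x : E, Measurable fun O : unitary (E →L[ℝ] E) => (O : E →L[ℝ] E) x := fun x =>
    measurable_unitary_apply.comp (measurable_id.prodMk measurable_const)
  have hqm : Measurable fun O : unitary (E →L[ℝ] E) =>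
      ‖⟪e, (O : E →L[ℝ] E) v⟫‖ₑ ^ (2 * k) := by
    have := hap v
    fun_prop
  have hjoint : Measurable fun p : EuclideanSpace ℝ (Fin m) × unitary (E →L[ℝ] E) =>
      H ((p.2 : E →L[ℝ] E) (W p.1)) :=
    hH.comp (measurable_unitary_apply.comp
      (measurable_snd.prodMk (W.continuous.measurable.comp measurable_fst)))
  -- By right invariance `u` may be replaced by any nonzero vector orthogonal to `v`.
  have heq : ∀ x : EuclideanSpace ℝ (Fin m), x ≠ 0 →
      ∫⁻ O, H ((O : E →L[ℝ] E) u) * ‖⟪e, (O : E →L[ℝ] E) v⟫‖ₑ ^ (2 * k) ∂ν =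
      ∫⁻ O, H ((O : E →L[ℝ] E) (W x)) * ‖⟪e, (O : E →L[ℝ] E) v⟫‖ₑ ^ (2 * k) ∂ν := by
    intro x hx
    have hu0 : ‖u‖ ≠ 0 := by simpa using hu
    have hx0 : ‖x‖ ≠ 0 := by simpa using hx
    obtain ⟨R, hR1, hR2⟩ := exists_unitary_map_pair (a₁ := W x) (a₂ := v)
      (b₁ := (‖x‖ / ‖u‖) • u) (b₂ := v) (by simp [norm_smul, hu0]) rfl
      (by rw [real_inner_comm]; exact hW x) (by rw [real_inner_smul_left, huv, mul_zero])
    rw [← lintegral_mul_right_eq_self (μ := ν) (fun O : unitary (E →L[ℝ] E) =>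
      H ((O : E →L[ℝ] E) (W x)) * ‖⟪e, (O : E →L[ℝ] E) v⟫‖ₑ ^ (2 * k)) R]
    refine lintegral_congr fun O => ?_
    simp only [Submonoid.coe_mul, mul_apply_eq_comp, hR1, hR2, map_smul]
    rw [hd _ (div_ne_zero hx0 hu0)]
  calc ∫⁻ O, H ((O : E →L[ℝ] E) u) * ‖⟪e, (O : E →L[ℝ] E) v⟫‖ₑ ^ (2 * k) ∂ν
      = ∫⁻ _ : EuclideanSpace ℝ (Fin m), (∫⁻ O, H ((O : E →L[ℝ] E) u) *
          ‖⟪e, (O : E →L[ℝ] E) v⟫‖ₑ ^ (2 * k) ∂ν) ∂stdGaussian (EuclideanSpace ℝ (Fin m)) := by simp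
    _ = ∫⁻ x : EuclideanSpace ℝ (Fin m), (∫⁻ O, H ((O : E →L[ℝ] E) (W x)) *
          ‖⟪e, (O : E →L[ℝ] E) v⟫‖ₑ ^ (2 * k) ∂ν) ∂stdGaussian (EuclideanSpace ℝ (Fin m)) := by
        refine lintegral_congr_ae ?_
        filter_upwards [ae_ne_zero_stdGaussian hm1] with x hx
        exact heq x hx
    _ = ∫⁻ O, (∫⁻ x : EuclideanSpace ℝ (Fin m), H ((O : E →L[ℝ] E) (W x)) *
          ‖⟪e, (O : E →L[ℝ] E) v⟫‖ₑ ^ (2 * k) ∂stdGaussian (EuclideanSpace ℝ (Fin m))) ∂ν := by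
        refine lintegral_lintegral_swap (Measurable.aemeasurable ?_)
        exact hjoint.mul (hqm.comp measurable_snd)
    _ ≤ ∫⁻ O, M * ‖⟪e, (O : E →L[ℝ] E) v⟫‖ₑ ^ (2 * k) ∂ν := by
        refine lintegral_mono fun O => ?_
        have hm' : Measurable fun x : EuclideanSpace ℝ (Fin m) => H ((O : E →L[ℝ] E) (W x)) :=
          hjoint.comp (measurable_id.prodMk measurable_const)
        rw [lintegral_mul_const _ hm']
        gcongr
        exact hM ((Unitary.linearIsometryEquiv O).toLinearIsometry.comp W)
    _ = M * ∫⁻ O, ‖⟪e, (O : E →L[ℝ] E) v⟫‖ₑ ^ (2 * k) ∂ν := lintegral_const_mul _ hqm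

theorem measurable_unitary_apply_left (x : E) :
    Measurable fun O : unitary (E →L[ℝ] E) => (O : E →L[ℝ] E) x :=
  measurable_unitary_apply.comp (measurable_id.prodMk measurable_const)

theorem measurable_unitary_inner_isometry {m : ℕ} (e : E)
    (W : EuclideanSpace ℝ (Fin m) →ₗᵢ[ℝ] E) :
    Measurable fun p : unitary (E →L[ℝ] E) × EuclideanSpace ℝ (Fin m) =>
      ⟪e, (p.1 : E →L[ℝ] E) (W p.2)⟫ :=
  measurable_const.inner (measurable_unitary_apply.comp
    (measurable_fst.prodMk (W.continuous.measurable.comp measurable_snd)))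

/-- The orbit average of a function of `O` weighted by the `2k`-th power of the distance from
`O y` to the axis `e` is an average of pair averages as in `lintegral_unitary_pair_le`. -/
theorem lintegral_orbit_moment {m : ℕ} {k : ℕ} {C : ℝ≥0∞}
    (hC : ∀ a : EuclideanSpace ℝ (Fin m),
      ∫⁻ x, ‖⟪a, x⟫‖ₑ ^ (2 * k) ∂stdGaussian (EuclideanSpace ℝ (Fin m)) = C * ‖a‖ₑ ^ (2 * k))
    {e : E} (he : ‖e‖ = 1) {y : E} (hy : y ≠ 0) (W : EuclideanSpace ℝ (Fin m) →ₗᵢ[ℝ] E)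
    (hW : ∀ x, ⟪y, W x⟫ = 0) (hW' : ∀ z, ⟪y, z⟫ = 0 → ∃ x, W x = z)
    {h : unitary (E →L[ℝ] E) → ℝ≥0∞} (hh : Measurable h) :
    C * ∫⁻ O, ‖(O : E →L[ℝ] E) y - ⟪e, (O : E →L[ℝ] E) y⟫ • e‖ₑ ^ (2 * k) * h O ∂ν =
      ‖y‖ₑ ^ (2 * k) * ∫⁻ x, ∫⁻ O, h O * ‖⟪e, (O : E →L[ℝ] E) (W x)⟫‖ₑ ^ (2 * k) ∂ν
        ∂stdGaussian (EuclideanSpace ℝ (Fin m)) := by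
  have hq := (measurable_unitary_inner_isometry e W).enorm.pow_const (2 * k)
  have hj : Measurable fun p : unitary (E →L[ℝ] E) × EuclideanSpace ℝ (Fin m) =>
      h p.1 * ‖⟪e, (p.1 : E →L[ℝ] E) (W p.2)⟫‖ₑ ^ (2 * k) := (hh.comp measurable_fst).mul hq
  have hw : Measurable fun O : unitary (E →L[ℝ] E) =>
      ‖(O : E →L[ℝ] E) y - ⟪e, (O : E →L[ℝ] E) y⟫ • e‖ₑ ^ (2 * k) * h O := by
    have := measurable_unitary_apply_left y
    fun_prop
  have hswap := lintegral_lintegral_swap (μ := ν)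
    (ν := stdGaussian (EuclideanSpace ℝ (Fin m)))
    (f := fun O x => h O * ‖⟪e, (O : E →L[ℝ] E) (W x)⟫‖ₑ ^ (2 * k)) hj.aemeasurable
  rw [← lintegral_const_mul _ hw, ← hswap, ← lintegral_const_mul _ hj.lintegral_prod_right']
  refine lintegral_congr fun O => ?_
  have hqO : Measurable fun x : EuclideanSpace ℝ (Fin m) =>
      ‖⟪e, (O : E →L[ℝ] E) (W x)⟫‖ₑ ^ (2 * k) :=
    (measurable_const.inner
      ((O : E →L[ℝ] E).continuous.comp W.continuous).measurable).enorm.pow_const _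
  dsimp only
  rw [← mul_assoc, moment_hyperplane hC he hy W hW hW' O, lintegral_const_mul _ hqO]
  ring

/-- Hyperplane means bounded by `M` bound the weighted orbit averages, the weight being an even
power of the distance to the axis `e`. -/
theorem lintegral_orbit_le [ν.IsMulRightInvariant] {m : ℕ}
    (hm : finrank ℝ E = m + 1) (hm1 : 1 ≤ m)
    {H : E → ℝ≥0∞} (hH : Measurable H) (hd : IsDirectional H) {M : ℝ≥0∞}
    (hM : ∀ W : EuclideanSpace ℝ (Fin m) →ₗᵢ[ℝ] E,
      ∫⁻ x, H (W x) ∂stdGaussian (EuclideanSpace ℝ (Fin m)) ≤ M)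
    {e : E} (he : ‖e‖ = 1) (k : ℕ) {y : E} (hy : y ≠ 0) :
    ∫⁻ O, ‖(O : E →L[ℝ] E) y - ⟪e, (O : E →L[ℝ] E) y⟫ • e‖ₑ ^ (2 * k) *
        H ((O : E →L[ℝ] E) y) ∂ν ≤
      M * ∫⁻ O, ‖(O : E →L[ℝ] E) y - ⟪e, (O : E →L[ℝ] E) y⟫ • e‖ₑ ^ (2 * k) ∂ν := by
  obtain ⟨W, hW, hW'⟩ := exists_linearIsometry_onto_orthogonal hm hy
  obtain ⟨C, hC0, hCt, hC⟩ := exists_moment_stdGaussian m k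
  have hq := (measurable_unitary_inner_isometry e W).enorm.pow_const (2 * k)
  have h1 := lintegral_orbit_moment ν hC he hy W hW hW'
    (hH.comp (measurable_unitary_apply_left y))
  have h2 := lintegral_orbit_moment ν hC he hy W hW hW' (h := fun _ => 1) measurable_const
  simp only [mul_one, one_mul, Function.comp_apply] at h1 h2
  have h3 : ∫⁻ x, ∫⁻ O, H ((O : E →L[ℝ] E) y) * ‖⟪e, (O : E →L[ℝ] E) (W x)⟫‖ₑ ^ (2 * k) ∂ν
        ∂stdGaussian (EuclideanSpace ℝ (Fin m)) ≤
      M * ∫⁻ x, ∫⁻ O, ‖⟪e, (O : E →L[ℝ] E) (W x)⟫‖ₑ ^ (2 * k) ∂ν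
        ∂stdGaussian (EuclideanSpace ℝ (Fin m)) := by
    rw [← lintegral_const_mul M hq.lintegral_prod_left']
    refine lintegral_mono_ae ?_
    filter_upwards [ae_ne_zero_stdGaussian hm1] with x hx
    refine lintegral_unitary_pair_le ν hm hm1 hH hd hM e k hy ?_ (hW x)
    rw [ne_eq, ← norm_eq_zero, W.norm_map]
    simpa using hx
  rw [← ENNReal.mul_le_mul_iff_right hC0 hCt, h1, mul_left_comm C M, h2, mul_left_comm M]
  exact mul_le_mul_right h3 _

/-- A radial weight does not see a rotation of the integration variable. -/
theorem lintegral_radial_mul {ρ : ℝ → ℝ≥0∞} (hρ : Measurable ρ) {G : E → ℝ≥0∞}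
    (hG : Measurable G) :
    ∫⁻ y, ρ ‖y‖ * G y = ∫⁻ y, ρ ‖y‖ * ∫⁻ O, G ((O : E →L[ℝ] E) y) ∂ν := by
  have hj : Measurable fun p : unitary (E →L[ℝ] E) × E => G ((p.1 : E →L[ℝ] E) p.2) :=
    hG.comp measurable_unitary_apply
  have h : ∀ O : unitary (E →L[ℝ] E),
      ∫⁻ y, ρ ‖y‖ * G y = ∫⁻ y, ρ ‖y‖ * G ((O : E →L[ℝ] E) y) := by
    intro O
    have := (Unitary.linearIsometryEquiv O).measurePreserving.lintegral_comp
      (f := fun y => ρ ‖y‖ * G y) (by fun_prop)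
    rw [← this]
    simp only [LinearIsometryEquiv.norm_map]
    rfl
  calc ∫⁻ y, ρ ‖y‖ * G y = ∫⁻ _, (∫⁻ y, ρ ‖y‖ * G y) ∂ν := by simp
    _ = ∫⁻ O, (∫⁻ y, ρ ‖y‖ * G ((O : E →L[ℝ] E) y)) ∂ν := lintegral_congr fun O => h O
    _ = ∫⁻ y, ∫⁻ O, ρ ‖y‖ * G ((O : E →L[ℝ] E) y) ∂ν :=
      lintegral_lintegral_swap (Measurable.aemeasurable
        ((hρ.comp measurable_snd.norm).mul hj))
    _ = _ := by
      refine lintegral_congr fun y => ?_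
      exact lintegral_const_mul _ (hj.comp (measurable_id.prodMk measurable_const))

/-- Hyperplane means of a directional function bounded by `M` bound its integrals against
radial densities times an even power of the distance to the axis `e`. -/
theorem lintegral_radial_le {m : ℕ} (hm : finrank ℝ E = m + 1) (hm1 : 1 ≤ m)
    {H : E → ℝ≥0∞} (hH : Measurable H) (hd : IsDirectional H) {M : ℝ≥0∞}
    (hM : ∀ W : EuclideanSpace ℝ (Fin m) →ₗᵢ[ℝ] E,
      ∫⁻ x, H (W x) ∂stdGaussian (EuclideanSpace ℝ (Fin m)) ≤ M)
    {e : E} (he : ‖e‖ = 1) (k : ℕ) {ρ : ℝ → ℝ≥0∞} (hρ : Measurable ρ) :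
    ∫⁻ y, ρ ‖y‖ * (‖y - ⟪e, y⟫ • e‖ₑ ^ (2 * k) * H y) ≤
      M * ∫⁻ y, ρ ‖y‖ * ‖y - ⟪e, y⟫ • e‖ₑ ^ (2 * k) := by
  obtain ⟨ν, hν, hν'⟩ := exists_rightInvariant_unitary E
  have : Nontrivial E := nontrivial_of_finrank_pos (R := ℝ) (by omega)
  rw [lintegral_radial_mul ν hρ (G := fun y => ‖y - ⟪e, y⟫ • e‖ₑ ^ (2 * k) * H y) (by fun_prop),
    lintegral_radial_mul ν hρ (G := fun y => ‖y - ⟪e, y⟫ • e‖ₑ ^ (2 * k)) (by fun_prop),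
    ← lintegral_const_mul]
  · refine lintegral_mono_ae ?_
    have h0 : ∀ᵐ y : E, y ≠ 0 := compl_mem_ae_iff.2 (measure_singleton 0)
    filter_upwards [h0] with y hy
    rw [mul_left_comm]
    gcongr
    exact lintegral_orbit_le ν hm hm1 hH hd hM he k hy
  · refine (hρ.comp measurable_norm).mul ?_
    refine Measurable.lintegral_prod_right'
      (f := fun p : E × unitary (E →L[ℝ] E) =>
        ‖(p.2 : E →L[ℝ] E) p.1 - ⟪e, (p.2 : E →L[ℝ] E) p.1⟫ • e‖ₑ ^ (2 * k)) ?_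
    have := (measurable_unitary_apply (E := E)).comp measurable_swap
    have h2 : Measurable fun y : E => ‖y - ⟪e, y⟫ • e‖ₑ ^ (2 * k) := by fun_prop
    exact h2.comp this

end Averaging

/-! ### Gaussian means over images of linear maps -/

section AxisScale

variable {E : Type*} [NormedAddCommGroup E] [InnerProductSpace ℝ E]

/-- The linear map that multiplies the component along `e` by `s` and fixes the hyperplane
orthogonal to `e` (for a unit vector `e`). -/
noncomputable def axisScale (e : E) (s : ℝ) : E →ₗ[ℝ] E :=
  LinearMap.id + (s - 1) • (innerₛₗ ℝ e).smulRight e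

theorem axisScale_apply (e : E) (s : ℝ) (x : E) :
    axisScale e s x = (x - ⟪e, x⟫ • e) + (s * ⟪e, x⟫) • e := by
  simp only [axisScale, LinearMap.add_apply, LinearMap.id_apply, LinearMap.smul_apply,
    LinearMap.smulRight_apply, innerₛₗ_apply_apply, smul_smul]
  rw [sub_mul, sub_smul, one_mul]
  abel

theorem inner_axisScale {e : E} (he : ‖e‖ = 1) (s : ℝ) (x : E) :
    ⟪e, axisScale e s x⟫ = s * ⟪e, x⟫ := by
  simp [axisScale_apply, inner_add_right, inner_sub_right, real_inner_smul_right, he]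

theorem axisScale_axisScale_inv {e : E} (he : ‖e‖ = 1) {s : ℝ} (hs : s ≠ 0) (x : E) :
    axisScale e s (axisScale e s⁻¹ x) = x := by
  rw [axisScale_apply, inner_axisScale he, axisScale_apply, ← mul_assoc, mul_inv_cancel₀ hs,
    one_mul]
  abel

theorem norm_sq_component_add {e : E} (he : ‖e‖ = 1) (t : ℝ) (x : E) :
    ‖(x - ⟪e, x⟫ • e) + t • e‖ ^ 2 = ‖x - ⟪e, x⟫ • e‖ ^ 2 + t ^ 2 := by
  have h : ⟪x - ⟪e, x⟫ • e, e⟫ = 0 := by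
    rw [inner_sub_left, real_inner_smul_left, real_inner_self_eq_norm_sq, he, real_inner_comm]
    ring
  rw [norm_add_sq_real, real_inner_smul_right, h, norm_smul, he, mul_one, Real.norm_eq_abs, sq_abs]
  ring

theorem norm_sq_eq_component {e : E} (he : ‖e‖ = 1) (x : E) :
    ‖x‖ ^ 2 = ‖x - ⟪e, x⟫ • e‖ ^ 2 + ⟪e, x⟫ ^ 2 := by
  rw [← norm_sq_component_add he, sub_add_cancel]

theorem ofReal_exp_eq_tsum {t : ℝ} (ht : 0 ≤ t) :
    ENNReal.ofReal (Real.exp t) = ∑' k : ℕ, ENNReal.ofReal (t ^ k / k.factorial) := by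
  rw [← ENNReal.ofReal_tsum_of_nonneg (fun k => by positivity) (Real.summable_pow_div_factorial t),
    Real.exp_eq_exp_ℝ, NormedSpace.exp_eq_tsum_div]

/-- The Gaussian density flattened along `e` is a radial density times
`exp (c * ‖y - ⟪e, y⟫ • e‖ ^ 2)` with `c ≥ 0`, hence a series with nonnegative coefficients in the
even powers of the distance to the axis `e`. Nonnegativity is where `s ≤ 1` is needed. -/
theorem gaussian_axisScale_inv {e : E} (he : ‖e‖ = 1) {s : ℝ} (hs : 0 < s) (hs1 : s ≤ 1) (y : E) :
    ENNReal.ofReal (Real.exp (-(‖axisScale e s⁻¹ y‖ ^ 2 / 2))) =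
      ∑' k : ℕ, ENNReal.ofReal (((s⁻¹ ^ 2 - 1) / 2) ^ k / k.factorial) *
        (ENNReal.ofReal (Real.exp (-(s⁻¹ ^ 2 * ‖y‖ ^ 2 / 2))) *
          ‖y - ⟪e, y⟫ • e‖ₑ ^ (2 * k)) := by
  have hc : 0 ≤ (s⁻¹ ^ 2 - 1) / 2 := by
    have : 1 ≤ s⁻¹ := (one_le_inv₀ hs).2 hs1
    nlinarith
  have h1 : -(‖axisScale e s⁻¹ y‖ ^ 2 / 2) =
      -(s⁻¹ ^ 2 * ‖y‖ ^ 2 / 2) + (s⁻¹ ^ 2 - 1) / 2 * ‖y - ⟪e, y⟫ • e‖ ^ 2 := by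
    rw [axisScale_apply, norm_sq_component_add he, norm_sq_eq_component he y]
    ring
  rw [h1, Real.exp_add, ENNReal.ofReal_mul (Real.exp_nonneg _),
    ofReal_exp_eq_tsum (t := (s⁻¹ ^ 2 - 1) / 2 * ‖y - ⟪e, y⟫ • e‖ ^ 2) (by positivity),
    ← ENNReal.tsum_mul_left]
  refine tsum_congr fun k => ?_
  have h2 : ((s⁻¹ ^ 2 - 1) / 2 * ‖y - ⟪e, y⟫ • e‖ ^ 2) ^ k / k.factorial =
      ((s⁻¹ ^ 2 - 1) / 2) ^ k / k.factorial * ‖y - ⟪e, y⟫ • e‖ ^ (2 * k) := by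
    rw [mul_pow, ← pow_mul]
    ring
  rw [h2, ENNReal.ofReal_mul (by positivity), ENNReal.ofReal_pow (norm_nonneg _),
    ofReal_norm]
  ring

variable [FiniteDimensional ℝ E] [CompleteSpace E] [MeasurableSpace E] [BorelSpace E]

/-- If all hyperplane means of a directional function are at most `M`, then so is its mean over a
Gaussian flattened in one direction: the direction of a flattened Gaussian is a mixture of uniform
directions in hyperplanes. -/
theorem lintegral_axisScale_le {m : ℕ} (hm : finrank ℝ E = m + 1) (hm1 : 1 ≤ m)
    {H : E → ℝ≥0∞} (hH : Measurable H) (hd : IsDirectional H) {M : ℝ≥0∞}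
    (hM : ∀ W : EuclideanSpace ℝ (Fin m) →ₗᵢ[ℝ] E,
      ∫⁻ x, H (W x) ∂stdGaussian (EuclideanSpace ℝ (Fin m)) ≤ M)
    {e : E} (he : ‖e‖ = 1) {s : ℝ} (hs : 0 < s) (hs1 : s ≤ 1) :
    ∫⁻ x, H (axisScale e s x) ∂stdGaussian E ≤ M := by
  obtain ⟨C, -, -, hC⟩ := exists_lintegral_stdGaussian E
  set D := axisScale e s
  set D' := axisScale e s⁻¹
  have hD'D : ∀ x, D' (D x) = x := fun x => by
    have := axisScale_axisScale_inv he (inv_ne_zero hs.ne') x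
    rwa [inv_inv] at this
  have hDm : Measurable D := (LinearMap.continuous_of_finiteDimensional D).measurable
  have hD'm : Measurable D' := (LinearMap.continuous_of_finiteDimensional D').measurable
  have hdet : LinearMap.det D ≠ 0 := by
    intro h0
    have h1 : D' ∘ₗ D = LinearMap.id := LinearMap.ext hD'D
    have h2 := congrArg LinearMap.det h1
    rw [LinearMap.det_comp, h0, mul_zero, LinearMap.det_id] at h2
    exact zero_ne_one h2
  set g : E → ℝ≥0∞ := fun y => ENNReal.ofReal (Real.exp (-(‖D' y‖ ^ 2 / 2)))
  have hg : Measurable g := by fun_prop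
  set c := ENNReal.ofReal |(LinearMap.det D)⁻¹|
  have hcv : ∀ f : E → ℝ≥0∞, Measurable f →
      ∫⁻ x, f (D x) ∂stdGaussian E = C * (c * ∫⁻ y, g y * f y) := by
    intro f hf
    rw [hC (fun x => f (D x)) (hf.comp hDm), ← smul_eq_mul c, ← lintegral_smul_measure,
      ← Measure.map_linearMap_addHaar_eq_smul_addHaar volume hdet,
      lintegral_map (f := fun y => g y * f y) (hg.mul hf) hDm]
    simp only [g, hD'D]
  have hk : ∀ f : E → ℝ≥0∞, Measurable f → ∫⁻ y, g y * f y =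
      ∑' k : ℕ, ENNReal.ofReal (((s⁻¹ ^ 2 - 1) / 2) ^ k / k.factorial) *
        ∫⁻ y, ENNReal.ofReal (Real.exp (-(s⁻¹ ^ 2 * ‖y‖ ^ 2 / 2))) *
          (‖y - ⟪e, y⟫ • e‖ₑ ^ (2 * k) * f y) := by
    intro f hf
    have : ∀ y, g y * f y = ∑' k : ℕ, ENNReal.ofReal (((s⁻¹ ^ 2 - 1) / 2) ^ k / k.factorial) *
        (ENNReal.ofReal (Real.exp (-(s⁻¹ ^ 2 * ‖y‖ ^ 2 / 2))) *
          (‖y - ⟪e, y⟫ • e‖ₑ ^ (2 * k) * f y)) := by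
      intro y
      rw [show g y = _ from gaussian_axisScale_inv he hs hs1 y, ← ENNReal.tsum_mul_right]
      refine tsum_congr fun k => ?_
      ring
    simp_rw [this]
    rw [lintegral_tsum fun k => Measurable.aemeasurable (by fun_prop)]
    refine tsum_congr fun k => ?_
    rw [lintegral_const_mul _ (by fun_prop)]
  have hle : ∫⁻ y, g y * H y ≤ M * ∫⁻ y, g y * 1 := by
    rw [hk H hH, hk _ measurable_const, ← ENNReal.tsum_mul_left]
    refine ENNReal.tsum_le_tsum fun k => ?_
    rw [mul_left_comm M]
    simp only [mul_one]
    refine mul_le_mul_right ?_ _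
    exact lintegral_radial_le hm hm1 hH hd hM he k
      (ρ := fun r => ENNReal.ofReal (Real.exp (-(s⁻¹ ^ 2 * r ^ 2 / 2)))) (by fun_prop)
  have hone := hcv (fun _ => 1) measurable_const
  simp only [lintegral_const, measure_univ, mul_one] at hone hle
  calc ∫⁻ x, H (D x) ∂stdGaussian E = C * (c * ∫⁻ y, g y * H y) := hcv H hH
    _ ≤ C * (c * (M * ∫⁻ y, g y)) := by gcongr
    _ = M * (C * (c * ∫⁻ y, g y)) := by ring
    _ = M := by rw [← hone, mul_one]

end AxisScale

section Reduction

variable {V : Type*} [NormedAddCommGroup V] [InnerProductSpace ℝ V]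
variable {E : Type*} [NormedAddCommGroup E] [InnerProductSpace ℝ E] [FiniteDimensional ℝ E]

/-- A unit vector along which `L` stretches least; it is a right singular vector, so `L` maps its
orthogonal complement into the orthogonal complement of its image. -/
theorem exists_unit_min_stretch [Nontrivial E] (L : E →ₗ[ℝ] V) :
    ∃ e : E, ‖e‖ = 1 ∧ (∀ x, ‖L e‖ * ‖x‖ ≤ ‖L x‖) ∧ ∀ x, ⟪e, x⟫ = 0 → ⟪L e, L x⟫ = 0 := by
  have : ProperSpace E := FiniteDimensional.proper_real E
  obtain ⟨e, he, hmin⟩ := (isCompact_sphere (0 : E) 1).exists_isMinOn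
    (NormedSpace.sphere_nonempty.2 zero_le_one)
    (LinearMap.continuous_of_finiteDimensional L).norm.continuousOn
  have he1 : ‖e‖ = 1 := by simpa using he
  have hst : ∀ x, ‖L e‖ * ‖x‖ ≤ ‖L x‖ := by
    intro x
    rcases eq_or_ne x 0 with rfl | hx
    · simp
    have hx' : 0 < ‖x‖ := by simpa using hx
    have h : ‖L e‖ ≤ ‖L (‖x‖⁻¹ • x)‖ := hmin (by simp [norm_smul, hx'.ne'])
    rw [map_smul, norm_smul, norm_inv, norm_norm, inv_mul_eq_div, le_div_iff₀ hx'] at h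
    exact h
  refine ⟨e, he1, hst, fun x hx => ?_⟩
  set p := ⟪L e, L x⟫
  set q := ‖L x‖ ^ 2 - ‖L e‖ ^ 2 * ‖x‖ ^ 2
  have hq : 0 ≤ q := by
    have := pow_le_pow_left₀ (by positivity) (hst x) 2
    rw [mul_pow] at this
    linarith
  -- Minimality of the stretch at `e` along the line `e + t x`.
  have hquad : ∀ t : ℝ, 0 ≤ 2 * t * p + t ^ 2 * q := by
    intro t
    have h := pow_le_pow_left₀ (by positivity) (hst (e + t • x)) 2
    rw [mul_pow, norm_add_sq_real, map_add, norm_add_sq_real, map_smul, real_inner_smul_right,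
      real_inner_smul_right, hx, norm_smul, norm_smul, he1, mul_pow, mul_pow, Real.norm_eq_abs,
      sq_abs] at h
    have : 2 * t * p + t ^ 2 * q = ‖L e‖ ^ 2 + 2 * (t * p) + t ^ 2 * ‖L x‖ ^ 2 -
        ‖L e‖ ^ 2 * (1 ^ 2 + 2 * (t * 0) + t ^ 2 * ‖x‖ ^ 2) := by
      simp only [q]; ring
    rw [this]
    linarith
  have h := hquad (-p / (q + 1))
  have h2 : 2 * (-p / (q + 1)) * p + (-p / (q + 1)) ^ 2 * q =
      -(p ^ 2 * (q + 2)) / (q + 1) ^ 2 := by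
    field_simp
    ring
  rw [h2, le_div_iff₀ (by positivity), zero_mul] at h
  have h3 : p ^ 2 ≤ 0 := by nlinarith [sq_nonneg p]
  exact pow_eq_zero_iff (two_ne_zero) |>.1 (le_antisymm h3 (sq_nonneg p))

theorem le_finrank_comap_isometry {m r : ℕ} (hm : finrank ℝ E = m + 1)
    (W : EuclideanSpace ℝ (Fin m) →ₗᵢ[ℝ] E) (S : Submodule ℝ E) (hS : r + 1 ≤ finrank ℝ S) :
    r ≤ finrank ℝ (S.comap W.toLinearMap) := by
  have h1 := Submodule.finrank_sup_add_finrank_inf_eq S (LinearMap.range W.toLinearMap)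
  have h2 : finrank ℝ (LinearMap.range W.toLinearMap) = m := by
    rw [LinearMap.finrank_range_of_inj W.injective, finrank_euclideanSpace_fin]
  have h3 := Submodule.finrank_le (S ⊔ LinearMap.range W.toLinearMap)
  have h4 : finrank ℝ (S.comap W.toLinearMap) =
      finrank ℝ (S ⊓ LinearMap.range W.toLinearMap : Submodule ℝ E) := by
    rw [inf_comm, ← Submodule.map_comap_eq]
    exact (LinearEquiv.finrank_eq
      (Submodule.equivMapOfInjective W.toLinearMap W.injective _))
  omega

theorem finrank_sup_span_singleton_of_notMem {S : Submodule ℝ E} {e : E} (he : e ∉ S) :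
    finrank ℝ (S ⊔ ℝ ∙ e : Submodule ℝ E) = finrank ℝ S + 1 := by
  have he0 : e ≠ 0 := fun h => he (h ▸ S.zero_mem)
  have h1 := Submodule.finrank_sup_add_finrank_inf_eq S (ℝ ∙ e)
  have h2 : S ⊓ ℝ ∙ e = ⊥ := ((Submodule.disjoint_span_singleton' he0).2 he).eq_bot
  rw [h2, finrank_bot, finrank_span_singleton he0] at h1
  omega

variable [MeasurableSpace V] [BorelSpace V]

/-- A mean over the image of a Gaussian under a linear map `L` of norm at most `b`, with `a` as a
lower bound on an `r`-dimensional subspace, is dominated by the means over images of `r`-dimensional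
Gaussians under maps with both bounds on the whole space. The dimension is lowered one at a time,
treating the direction `e` that `L` stretches least. -/
theorem lintegral_stdGaussian_linear_le {F : V → ℝ≥0∞} (hF : Measurable F) (hd : IsDirectional F)
    {M : ℝ≥0∞} {r : ℕ} (hr : 1 ≤ r) {a b : ℝ} (ha : 0 < a)
    (hM : ∀ L : EuclideanSpace ℝ (Fin r) →ₗ[ℝ] V, (∀ x, a * ‖x‖ ≤ ‖L x‖) →
      (∀ x, ‖L x‖ ≤ b * ‖x‖) → ∫⁻ x, F (L x) ∂stdGaussian (EuclideanSpace ℝ (Fin r)) ≤ M)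
    {m : ℕ} (hrm : r ≤ m) (L : EuclideanSpace ℝ (Fin m) →ₗ[ℝ] V) (hLb : ∀ x, ‖L x‖ ≤ b * ‖x‖)
    (S : Submodule ℝ (EuclideanSpace ℝ (Fin m))) (hS : r ≤ finrank ℝ S)
    (hSa : ∀ x ∈ S, a * ‖x‖ ≤ ‖L x‖) :
    ∫⁻ x, F (L x) ∂stdGaussian (EuclideanSpace ℝ (Fin m)) ≤ M := by
  induction m, hrm using Nat.le_induction with
  | base =>
    have : S = ⊤ := Submodule.eq_top_of_finrank_eq (by
      have := Submodule.finrank_le S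
      rw [finrank_euclideanSpace_fin] at this ⊢
      omega)
    exact hM L (fun x => hSa x (this ▸ Submodule.mem_top)) hLb
  | succ m hrm ih =>
    have hm : finrank ℝ (EuclideanSpace ℝ (Fin (m + 1))) = m + 1 := finrank_euclideanSpace_fin
    obtain ⟨e, he, hmin, horth⟩ := exists_unit_min_stretch L
    have hLm : ∀ L : EuclideanSpace ℝ (Fin (m + 1)) →ₗ[ℝ] V, Measurable fun x => F (L x) :=
      fun L => hF.comp (LinearMap.continuous_of_finiteDimensional L).measurable
    have hperp : ∀ x, ⟪e, x - ⟪e, x⟫ • e⟫ = 0 := fun x => by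
      simp [inner_sub_right, real_inner_smul_right, he]
    -- `L` maps the splitting along `e` to an orthogonal splitting.
    have hsplit : ∀ (x : EuclideanSpace ℝ (Fin (m + 1))) (t : ℝ),
        ‖L ((x - ⟪e, x⟫ • e) + t • e)‖ ^ 2 =
          ‖L (x - ⟪e, x⟫ • e)‖ ^ 2 + t ^ 2 * ‖L e‖ ^ 2 := by
      intro x t
      have h0 : ⟪L (x - ⟪e, x⟫ • e), L e⟫ = 0 := by
        rw [real_inner_comm]
        exact horth _ (hperp x)
      rw [map_add, norm_add_sq_real, map_smul, real_inner_smul_right, h0, norm_smul,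
        mul_pow, Real.norm_eq_abs, sq_abs]
      ring
    rcases le_or_gt a ‖L e‖ with hcase | hcase
    · -- `L` is bounded below by `a` everywhere, and so is its restriction to any hyperplane.
      -- Scaling by `s = 1` is the identity.
      have := lintegral_axisScale_le hm (hr.trans hrm) (hLm L) (hd.comp_linear L) (M := M)
        (fun W => ih (L ∘ₗ W.toLinearMap) (fun x => by simpa using hLb (W x)) ⊤
          (by rw [finrank_top, finrank_euclideanSpace_fin]; exact hrm)
          (fun x _ => by
            have h1 := hmin (W x)
            rw [W.norm_map] at h1
            exact (mul_le_mul_of_nonneg_right hcase (norm_nonneg x)).trans h1))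
        he one_pos le_rfl
      simpa [axisScale] using this
    have hmem : e ∉ S := fun h => by
      have := hSa e h
      rw [he, mul_one] at this
      linarith
    -- The extra dimension of `T` compensates for the one lost by restricting to a hyperplane.
    set T := S ⊔ ℝ ∙ e
    have hT : r + 1 ≤ finrank ℝ T := by
      rw [finrank_sup_span_singleton_of_notMem hmem]; omega
    have hTa : ∀ x ∈ T, a * ‖x - ⟪e, x⟫ • e‖ ≤ ‖L (x - ⟪e, x⟫ • e)‖ := by
      intro x hx
      obtain ⟨v, hv, w, hw, rfl⟩ := Submodule.mem_sup.1 hx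
      obtain ⟨t, rfl⟩ := Submodule.mem_span_singleton.1 hw
      have hvt : v + t • e - ⟪e, v + t • e⟫ • e = v - ⟪e, v⟫ • e := by
        rw [inner_add_right, real_inner_smul_right, real_inner_self_eq_norm_sq, he, add_smul]
        simp
      rw [hvt]
      have h1 := pow_le_pow_left₀ (by positivity) (hSa v hv) 2
      have h2 := hsplit v ⟪e, v⟫
      rw [sub_add_cancel] at h2
      rw [mul_pow, h2, norm_sq_eq_component he v] at h1
      have h3 : ‖L e‖ ^ 2 ≤ a ^ 2 := pow_le_pow_left₀ (norm_nonneg _) hcase.le 2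
      refine le_of_sq_le_sq ?_ (norm_nonneg _)
      rw [mul_pow]
      nlinarith [sq_nonneg ⟪e, v⟫]
    rcases eq_or_ne (L e) 0 with h0 | h0
    · -- `L` factors through the orthogonal projection along `e`.
      obtain ⟨W, hW, hW'⟩ := exists_linearIsometry_onto_orthogonal hm (y := e)
        (fun h => by simp [h] at he)
      have hfac : ∀ x, L x = L (W (LinearMap.adjoint W.toLinearMap x)) := by
        intro x
        obtain ⟨z, hz⟩ := hW' _ (hperp x)
        have hx : x = W z + ⟪e, x⟫ • e := by rw [hz, sub_add_cancel]
        have : LinearMap.adjoint W.toLinearMap x = z := by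
          refine ext_inner_right ℝ fun v => ?_
          rw [LinearMap.adjoint_inner_left]
          conv_lhs => rw [hx]
          simp [inner_add_left, real_inner_smul_left, hW]
        rw [this, hz, map_sub, map_smul, h0, smul_zero, sub_zero]
      have hLW : Measurable fun x => F (L (W x)) := (hLm L).comp W.continuous.measurable
      have h1 := ih (L ∘ₗ W.toLinearMap) (fun x => by simpa using hLb (W x))
        (T.comap W.toLinearMap) (le_finrank_comap_isometry hm W T hT) (fun x hx => by
          have := hTa (W x) hx
          rwa [hW, zero_smul, sub_zero, W.norm_map] at this)
      simp only [LinearMap.comp_apply, LinearIsometry.coe_toLinearMap] at h1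
      rw [← stdGaussian_map_adjoint W, lintegral_map hLW
        (LinearMap.continuous_of_finiteDimensional _).measurable] at h1
      exact (lintegral_congr fun x => congrArg F (hfac x)).trans_le h1
    · have hLe : 0 < ‖L e‖ := by simpa using h0
      -- `L'` agrees with `L` on the complement of `e` and stretches `e` by exactly `a`; flattening
      -- along `e` by `s = ‖L e‖ / a ≤ 1` before applying `L'` gives `L` back.
      set s := ‖L e‖ / a
      have hs : 0 < s := div_pos hLe ha
      have hs1 : s ≤ 1 := (div_le_one ha).2 hcase.le
      have hab : a ≤ b := by
        obtain ⟨x, hx, hx0⟩ := S.exists_mem_ne_zero_of_ne_bot (by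
          rintro rfl
          rw [finrank_bot] at hS
          omega)
        have hx' : 0 < ‖x‖ := by simpa using hx0
        exact le_of_mul_le_mul_right ((hSa x hx).trans (hLb x)) hx'
      set L' := L ∘ₗ axisScale e s⁻¹
      have hLL' : ∀ x, L x = L' (axisScale e s x) := fun x => by
        have := axisScale_axisScale_inv he (inv_ne_zero hs.ne') x
        rw [inv_inv] at this
        simp [L', this]
      have hL' : ∀ x, ‖L' x‖ ^ 2 = ‖L (x - ⟪e, x⟫ • e)‖ ^ 2 + ⟪e, x⟫ ^ 2 * a ^ 2 := by
        intro x
        simp only [L', LinearMap.comp_apply]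
        rw [axisScale_apply, hsplit, mul_pow]
        simp only [s]
        field_simp
      have hL'b : ∀ x, ‖L' x‖ ≤ b * ‖x‖ := by
        intro x
        refine le_of_sq_le_sq ?_ (mul_nonneg (ha.le.trans hab) (norm_nonneg x))
        have h1 := pow_le_pow_left₀ (norm_nonneg _) (hLb (x - ⟪e, x⟫ • e)) 2
        have h2 := mul_le_mul_of_nonneg_left (pow_le_pow_left₀ ha.le hab 2) (sq_nonneg ⟪e, x⟫)
        rw [mul_pow] at h1
        rw [hL', mul_pow, norm_sq_eq_component he x]
        linarith
      have hL'a : ∀ x ∈ T, a * ‖x‖ ≤ ‖L' x‖ := by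
        intro x hx
        refine le_of_sq_le_sq ?_ (norm_nonneg _)
        have h1 := pow_le_pow_left₀ (by positivity) (hTa x hx) 2
        rw [mul_pow] at h1
        rw [hL', mul_pow, norm_sq_eq_component he x]
        linarith
      simp_rw [hLL']
      refine lintegral_axisScale_le hm (hr.trans hrm) (hLm L') (hd.comp_linear L') (fun W => ?_)
        he hs hs1
      exact ih (L' ∘ₗ W.toLinearMap) (fun x => by simpa using hL'b (W x))
        (T.comap W.toLinearMap) (le_finrank_comap_isometry hm W T hT) (fun x hx => by
          simpa using hL'a (W x) hx)

end Reduction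

/-! ### Singular values -/

section SingularValues

variable {E : Type*} [NormedAddCommGroup E] [InnerProductSpace ℝ E]

theorem norm_sq_eq_sum_inner_sq {n : ℕ} (v : OrthonormalBasis (Fin n) ℝ E) (x : E) :
    ‖x‖ ^ 2 = ∑ i, ⟪v i, x⟫ ^ 2 := by
  rw [← v.sum_sq_norm_inner_right x]
  simp

variable [FiniteDimensional ℝ E]
variable {F : Type*} [NormedAddCommGroup F] [InnerProductSpace ℝ F] [FiniteDimensional ℝ F]

/-- Right singular vectors. -/
theorem exists_rightSingularBasis (T : E →ₗ[ℝ] F) {n : ℕ} (hn : finrank ℝ E = n) :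
    ∃ v : OrthonormalBasis (Fin n) ℝ E,
      ∀ i, LinearMap.adjoint T (T (v i)) = (T.singularValues i ^ 2) • v i := by
  refine ⟨T.isSymmetric_adjoint_comp_self.eigenvectorBasis hn, fun i => ?_⟩
  have := T.isSymmetric_adjoint_comp_self.apply_eigenvectorBasis hn i
  rw [T.sq_singularValues_fin hn]
  exact this

theorem norm_apply_sq_eq_sum {T : E →ₗ[ℝ] F} {n : ℕ} {v : OrthonormalBasis (Fin n) ℝ E}
    (hv : ∀ i, LinearMap.adjoint T (T (v i)) = (T.singularValues i ^ 2) • v i) (x : E) :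
    ‖T x‖ ^ 2 = ∑ i : Fin n, T.singularValues i ^ 2 * ⟪v i, x⟫ ^ 2 := by
  rw [← real_inner_self_eq_norm_sq, ← LinearMap.adjoint_inner_right,
    ← v.sum_inner_mul_inner]
  refine Finset.sum_congr rfl fun i _ => ?_
  rw [LinearMap.adjoint_inner_right, ← LinearMap.adjoint_inner_left, hv, real_inner_smul_left,
    real_inner_comm]
  ring

theorem norm_adjoint_apply_le {T : E →ₗ[ℝ] F} {c : ℝ} (hc : ∀ i, T.singularValues i ≤ c) (y : F) :
    ‖LinearMap.adjoint T y‖ ≤ c * ‖y‖ := by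
  have hc0 : 0 ≤ c := (T.singularValues_nonneg 0).trans (hc 0)
  have hT : ∀ x, ‖T x‖ ≤ c * ‖x‖ := by
    intro x
    obtain ⟨v, hv⟩ := exists_rightSingularBasis T rfl
    refine le_of_sq_le_sq ?_ (by positivity)
    rw [norm_apply_sq_eq_sum hv, mul_pow, norm_sq_eq_sum_inner_sq v, Finset.mul_sum]
    refine Finset.sum_le_sum fun i _ => ?_
    gcongr
    · exact T.singularValues_nonneg _
    · exact hc _
  have h1 : ‖LinearMap.adjoint T y‖ ^ 2 ≤ c * ‖y‖ * ‖LinearMap.adjoint T y‖ := by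
    rw [← real_inner_self_eq_norm_sq, LinearMap.adjoint_inner_left]
    calc ⟪y, T (LinearMap.adjoint T y)⟫ ≤ ‖y‖ * ‖T (LinearMap.adjoint T y)‖ :=
          real_inner_le_norm _ _
      _ ≤ ‖y‖ * (c * ‖LinearMap.adjoint T y‖) := by gcongr; exact hT _
      _ = _ := by ring
  rcases eq_or_lt_of_le (norm_nonneg (LinearMap.adjoint T y)) with h | h
  · rw [← h]; positivity
  · rw [pow_two] at h1
    exact le_of_mul_le_mul_right h1 h

/-- The images under `T` of the first `r` right singular vectors span the required subspace. -/
theorem exists_subspace_le_norm_adjoint {T : E →ₗ[ℝ] F} {r : ℕ} (hr : r ≤ finrank ℝ E) {a : ℝ}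
    (ha : 0 < a) (hT : ∀ i < r, a ≤ T.singularValues i) :
    ∃ S : Submodule ℝ F, finrank ℝ S = r ∧ ∀ y ∈ S, a * ‖y‖ ≤ ‖LinearMap.adjoint T y‖ := by
  obtain ⟨v, hv⟩ := exists_rightSingularBasis T rfl
  have hin : ∀ i j, ⟪T (v i), T (v j)⟫ = T.singularValues i ^ 2 * ⟪v i, v j⟫ := fun i j => by
    rw [← LinearMap.adjoint_inner_left, hv, real_inner_smul_left]
  let u : Fin r → E := fun i => v (Fin.castLE hr i)
  have hli : LinearIndependent ℝ fun i => T (u i) := by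
    refine linearIndependent_of_ne_zero_of_inner_eq_zero (𝕜 := ℝ) (fun i h0 => ?_)
      (fun i j hij => ?_)
    · have h1 := hin (Fin.castLE hr i) (Fin.castLE hr i)
      have h2 : T (v (Fin.castLE hr i)) = 0 := h0
      rw [h2, inner_zero_left, real_inner_self_eq_norm_sq, v.norm_eq_one] at h1
      have h3 := hT i i.2
      have h4 : 0 < T.singularValues i ^ 2 := pow_pos (ha.trans_le h3) 2
      simp only [Fin.val_castLE] at h1
      linarith
    · change ⟪T (v _), T (v _)⟫ = 0
      rw [hin, v.inner_eq_zero (fun h => hij (Fin.castLE_injective hr h)), mul_zero]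
  refine ⟨Submodule.span ℝ (Set.range fun i => T (u i)), ?_, ?_⟩
  · rw [finrank_span_eq_card hli, Fintype.card_fin]
  intro y hy
  have hy' : y ∈ (Submodule.span ℝ (Set.range u)).map T := by
    rw [Submodule.map_span, ← Set.range_comp]
    exact hy
  obtain ⟨x, hx, rfl⟩ := Submodule.mem_map.1 hy'
  have hx0 : ∀ i : Fin (finrank ℝ E), r ≤ i → ⟪v i, x⟫ = 0 := by
    intro i hi
    have hle : Submodule.span ℝ (Set.range u) ≤ (ℝ ∙ v i)ᗮ := by
      rw [Submodule.span_le]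
      rintro _ ⟨j, rfl⟩
      rw [SetLike.mem_coe, Submodule.mem_orthogonal_singleton_iff_inner_right]
      refine v.inner_eq_zero fun h => ?_
      have := congrArg Fin.val h
      simp only [Fin.val_castLE] at this
      omega
    exact Submodule.mem_orthogonal_singleton_iff_inner_right.1 (hle hx)
  refine le_of_sq_le_sq ?_ (norm_nonneg _)
  rw [mul_pow, norm_apply_sq_eq_sum hv, norm_sq_eq_sum_inner_sq v, Finset.mul_sum]
  refine Finset.sum_le_sum fun i _ => ?_
  rw [LinearMap.adjoint_inner_right, ← LinearMap.adjoint_inner_left, hv, real_inner_smul_left]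
  rcases lt_or_ge (i : ℕ) r with hi | hi
  · have h1 := pow_le_pow_left₀ ha.le (hT i hi) 2
    calc a ^ 2 * (T.singularValues i ^ 2 * ⟪v i, x⟫ ^ 2)
        ≤ T.singularValues i ^ 2 * (T.singularValues i ^ 2 * ⟪v i, x⟫ ^ 2) := by gcongr
      _ = _ := by ring
  · rw [hx0 i hi]; simp

/-- Two-sided bounds on `L` bound the first `finrank F` singular values of its adjoint. -/
theorem singularValues_adjoint_mem {L : F →ₗ[ℝ] E} {a b : ℝ} (ha : 0 < a)
    (hLa : ∀ x, a * ‖x‖ ≤ ‖L x‖) (hLb : ∀ x, ‖L x‖ ≤ b * ‖x‖) {i : ℕ} (hi : i < finrank ℝ F) :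
    a ≤ (LinearMap.adjoint L).singularValues i ∧ (LinearMap.adjoint L).singularValues i ≤ b := by
  set T := LinearMap.adjoint L
  have hinj : Function.Injective L := by
    rw [injective_iff_map_eq_zero]
    intro x hx
    have := hLa x
    rw [hx, norm_zero] at this
    by_contra h
    have h2 : 0 < ‖x‖ := by simpa using h
    nlinarith
  have hsurj : finrank ℝ (LinearMap.range T) = finrank ℝ F := by
    have h1 : (LinearMap.range T)ᗮ = ⊥ := by
      rw [LinearMap.orthogonal_range, LinearMap.adjoint_adjoint, LinearMap.ker_eq_bot.2 hinj]
    rw [Submodule.orthogonal_eq_bot_iff.1 h1, finrank_top]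
  have hpos : 0 < T.singularValues i := T.singularValues_pos_iff_lt_finrank_range.2 (hsurj ▸ hi)
  have hiE : i < finrank ℝ E :=
    hi.trans_le (LinearMap.finrank_le_finrank_of_injective hinj)
  obtain ⟨v, hv⟩ := exists_rightSingularBasis T rfl
  have hvi := hv ⟨i, hiE⟩
  rw [LinearMap.adjoint_adjoint] at hvi
  have hn : ‖T (v ⟨i, hiE⟩)‖ = T.singularValues i := by
    rw [← sq_eq_sq₀ (norm_nonneg _) hpos.le, ← real_inner_self_eq_norm_sq,
      ← LinearMap.adjoint_inner_left, LinearMap.adjoint_adjoint, hvi, real_inner_smul_left,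
      real_inner_self_eq_norm_sq, v.norm_eq_one]
    simp
  have hn2 : ‖L (T (v ⟨i, hiE⟩))‖ = T.singularValues i ^ 2 := by
    rw [hvi, norm_smul, v.norm_eq_one, mul_one, Real.norm_of_nonneg (sq_nonneg _)]
  have h1 := hLa (T (v ⟨i, hiE⟩))
  have h2 := hLb (T (v ⟨i, hiE⟩))
  rw [hn, hn2, pow_two] at h1 h2
  exact ⟨le_of_mul_le_mul_right h1 hpos, le_of_mul_le_mul_right h2 hpos⟩

/-- Singular values depend only on the Gram operator. -/
theorem singularValues_congr {F' : Type*} [NormedAddCommGroup F'] [InnerProductSpace ℝ F']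
    [FiniteDimensional ℝ F'] {T : E →ₗ[ℝ] F} {T' : E →ₗ[ℝ] F'}
    (h : LinearMap.adjoint T ∘ₗ T = LinearMap.adjoint T' ∘ₗ T') :
    T.singularValues = T'.singularValues := by
  ext i
  rcases lt_or_ge i (finrank ℝ E) with hi | hi
  · rw [T.singularValues_of_lt rfl hi, T'.singularValues_of_lt rfl hi]
    congr! 2
  · rw [T.singularValues_of_finrank_le hi, T'.singularValues_of_finrank_le hi]

end SingularValues

section Matrices

/-- Extension by zero of a vector to a longer one. -/
theorem exists_zeroExtension {r d : ℕ} (hrd : r ≤ d) :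
    ∃ W : EuclideanSpace ℝ (Fin r) →ₗᵢ[ℝ] EuclideanSpace ℝ (Fin d),
      ∀ x (i : Fin d), W x i = if h : (i : ℕ) < r then x ⟨i, h⟩ else 0 := by
  let W₀ : EuclideanSpace ℝ (Fin r) →ₗ[ℝ] EuclideanSpace ℝ (Fin d) :=
    { toFun := fun x => WithLp.toLp 2 fun i => if h : (i : ℕ) < r then x ⟨i, h⟩ else 0
      map_add' := fun x y => by
        ext i
        by_cases h : (i : ℕ) < r <;> simp [h]
      map_smul' := fun t x => by
        ext i
        by_cases h : (i : ℕ) < r <;> simp [h] }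
  refine ⟨⟨W₀, fun x => ?_⟩, fun x i => rfl⟩
  rw [← sq_eq_sq₀ (norm_nonneg _) (norm_nonneg _), EuclideanSpace.real_norm_sq_eq,
    EuclideanSpace.real_norm_sq_eq]
  symm
  refine Fintype.sum_of_injective (Fin.castLE hrd) (Fin.castLE_injective hrd) _ _ ?_ ?_
  · intro i hi
    have : ¬ (i : ℕ) < r := fun h => hi ⟨⟨i, h⟩, rfl⟩
    simp [W₀, this]
  · intro i
    simp [W₀]

theorem toEuclideanLin_padRows {r d n : ℕ} (B : Matrix (Fin r) (Fin n) ℝ)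
    {W : EuclideanSpace ℝ (Fin r) →ₗᵢ[ℝ] EuclideanSpace ℝ (Fin d)}
    (hW : ∀ x (i : Fin d), W x i = if h : (i : ℕ) < r then x ⟨i, h⟩ else 0) :
    Matrix.toEuclideanLin (padRows d B) = W.toLinearMap ∘ₗ Matrix.toEuclideanLin B := by
  ext x i
  simp only [LinearMap.comp_apply, LinearIsometry.coe_toLinearMap, hW]
  by_cases h : (i : ℕ) < r <;> simp [padRows, Matrix.toLpLin_apply, Matrix.mulVec, dotProduct, h]

theorem singularValues_padRows {r d n : ℕ} (hrd : r ≤ d) (B : Matrix (Fin r) (Fin n) ℝ) :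
    (Matrix.toEuclideanLin (padRows d B)).singularValues =
      (Matrix.toEuclideanLin B).singularValues := by
  obtain ⟨W, hW⟩ := exists_zeroExtension hrd
  refine singularValues_congr ?_
  ext1 x
  refine ext_inner_right ℝ fun y => ?_
  rw [toEuclideanLin_padRows B hW]
  simp [LinearMap.adjoint_inner_left]

theorem linearIndependent_row_of_mem_singularClass {r d : ℕ} {c : ℝ} (hr : 1 ≤ r) (hc : 0 < c)
    {B : Matrix (Fin r) (Fin d) ℝ} (hB : B ∈ singularClass r d r c) :
    LinearIndependent ℝ B.row := by
  have h := (hB (r - 1) (by omega)).1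
  have h1 : 0 < (Matrix.toEuclideanLin B).singularValues (r - 1) :=
    (by positivity : (0 : ℝ) < 1 / c).trans_le h
  rw [LinearMap.singularValues_pos_iff_lt_finrank_range] at h1
  rw [linearIndependent_iff_card_le_finrank_span, Set.finrank, ← Matrix.rank_eq_finrank_span_row,
    Fintype.card_fin, Matrix.rank_eq_finrank_range_toLin B (EuclideanSpace.basisFun _ ℝ).toBasis
      (EuclideanSpace.basisFun _ ℝ).toBasis]
  rw [Matrix.toEuclideanLin_eq_toLin_orthonormal] at h1
  omega

end Matrices

/-! ### Sliced mutual information as a Gaussian mean -/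

section DoubleMeans

variable {m n : ℕ} {f : EuclideanSpace ℝ (Fin m) → EuclideanSpace ℝ (Fin n) → ℝ≥0∞}

theorem surfaceMeasure_univ_ne_zero {m : ℕ} (hm : 1 ≤ m) : surfaceMeasure m Set.univ ≠ 0 := by
  have : Nonempty (Fin m) := ⟨⟨0, hm⟩⟩
  rw [ne_eq, Measure.measure_univ_eq_zero]
  exact Measure.toSphere_ne_zero _

instance isFiniteMeasure_surfaceMeasure (m : ℕ) : IsFiniteMeasure (surfaceMeasure m) := by
  unfold surfaceMeasure
  infer_instance

/-- Normalized double integrals over spheres as double Gaussian means. -/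
theorem lintegral_surfaceMeasure_prod (hm : 1 ≤ m) (hn : 1 ≤ n)
    (hf : Measurable fun p : EuclideanSpace ℝ (Fin m) × EuclideanSpace ℝ (Fin n) => f p.1 p.2)
    (hl : ∀ h, IsDirectional fun g => f g h) (hr : ∀ g, IsDirectional (f g)) :
    (surfaceMeasure m Set.univ * surfaceMeasure n Set.univ)⁻¹ *
      ∫⁻ θ, ∫⁻ φ, f θ φ ∂(surfaceMeasure n) ∂(surfaceMeasure m) =
    ∫⁻ g, ∫⁻ h, f g h ∂stdGaussian (EuclideanSpace ℝ (Fin n))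
      ∂stdGaussian (EuclideanSpace ℝ (Fin m)) := by
  have : Nonempty (Fin m) := ⟨⟨0, hm⟩⟩
  have : Nonempty (Fin n) := ⟨⟨0, hn⟩⟩
  rw [ENNReal.mul_inv (Or.inl (surfaceMeasure_univ_ne_zero hm)) (Or.inl (measure_ne_top _ _)),
    mul_assoc, ← lintegral_const_mul' _ _ (ENNReal.inv_ne_top.2 (surfaceMeasure_univ_ne_zero hn))]
  have hin : ∀ g, (surfaceMeasure n Set.univ)⁻¹ * ∫⁻ φ, f g φ ∂(surfaceMeasure n) =
      ∫⁻ h, f g h ∂stdGaussian (EuclideanSpace ℝ (Fin n)) := fun g =>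
    lintegral_toSphere_eq_stdGaussian (hf.comp (measurable_prodMk_left (x := g))) (hr g)
  simp_rw [hin]
  exact lintegral_toSphere_eq_stdGaussian hf.lintegral_prod_right'
    fun t ht g => lintegral_congr fun h => hl h t ht g

theorem lintegral_stdGaussian_comp_adjoint {m' n' : ℕ}
    (hf : Measurable fun p : EuclideanSpace ℝ (Fin m) × EuclideanSpace ℝ (Fin n) => f p.1 p.2)
    (W : EuclideanSpace ℝ (Fin m) →ₗᵢ[ℝ] EuclideanSpace ℝ (Fin m'))
    (Z : EuclideanSpace ℝ (Fin n) →ₗᵢ[ℝ] EuclideanSpace ℝ (Fin n')) :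
    ∫⁻ g, ∫⁻ h, f (LinearMap.adjoint W.toLinearMap g) (LinearMap.adjoint Z.toLinearMap h)
        ∂stdGaussian (EuclideanSpace ℝ (Fin n')) ∂stdGaussian (EuclideanSpace ℝ (Fin m')) =
      ∫⁻ g, ∫⁻ h, f g h ∂stdGaussian (EuclideanSpace ℝ (Fin n))
        ∂stdGaussian (EuclideanSpace ℝ (Fin m)) := by
  have h1 : Measurable fun g => ∫⁻ h, f g h ∂stdGaussian (EuclideanSpace ℝ (Fin n)) :=
    hf.lintegral_prod_right'
  rw [← stdGaussian_map_adjoint W, lintegral_map h1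
    (LinearMap.continuous_of_finiteDimensional _).measurable]
  refine lintegral_congr fun g => ?_
  have h2 : Measurable (f (LinearMap.adjoint W.toLinearMap g)) :=
    hf.comp (measurable_prodMk_left (x := LinearMap.adjoint W.toLinearMap g))
  rw [← stdGaussian_map_adjoint Z, lintegral_map h2
    (LinearMap.continuous_of_finiteDimensional _).measurable]

end DoubleMeans

section SlicedInformation

variable {Ω : Type*} [MeasurableSpace Ω] (μ : Measure Ω) {dx dy : ℕ}
  (X : Ω → EuclideanSpace ℝ (Fin dx)) (Y : Ω → EuclideanSpace ℝ (Fin dy))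

/-- The mean of `I((L g)ᵀX; (K h)ᵀY)` over independent standard Gaussian vectors `g`, `h`. -/
noncomputable def gaussianMI {m n : ℕ}
    (L : EuclideanSpace ℝ (Fin m) →ₗ[ℝ] EuclideanSpace ℝ (Fin dx))
    (K : EuclideanSpace ℝ (Fin n) →ₗ[ℝ] EuclideanSpace ℝ (Fin dy)) : ℝ≥0∞ :=
  ∫⁻ g, ∫⁻ h, projInfo μ X Y (L g) (K h) ∂stdGaussian (EuclideanSpace ℝ (Fin n))
    ∂stdGaussian (EuclideanSpace ℝ (Fin m))

variable [IsProbabilityMeasure μ] {X Y}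

theorem measurable_projInfo_linear (hX : Measurable X) (hY : Measurable Y) {m n : ℕ}
    (L : EuclideanSpace ℝ (Fin m) →ₗ[ℝ] EuclideanSpace ℝ (Fin dx))
    (K : EuclideanSpace ℝ (Fin n) →ₗ[ℝ] EuclideanSpace ℝ (Fin dy)) :
    Measurable fun p : EuclideanSpace ℝ (Fin m) × EuclideanSpace ℝ (Fin n) =>
      projInfo μ X Y (L p.1) (K p.2) := by
  have hL : Measurable L := (LinearMap.continuous_of_finiteDimensional L).measurable
  have hK : Measurable K := (LinearMap.continuous_of_finiteDimensional K).measurable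
  exact (measurable_projInfo μ hX hY).comp
    ((hL.comp measurable_fst).prodMk (hK.comp measurable_snd))

theorem isDirectional_projInfo_left (hX : Measurable X) (hY : Measurable Y)
    (w : EuclideanSpace ℝ (Fin dy)) : IsDirectional fun v => projInfo μ X Y v w :=
  fun t ht v => by simpa using projInfo_smul μ hX hY ht one_ne_zero v w

theorem isDirectional_projInfo_right (hX : Measurable X) (hY : Measurable Y)
    (v : EuclideanSpace ℝ (Fin dx)) : IsDirectional fun w => projInfo μ X Y v w :=
  fun t ht w => by simpa using projInfo_smul μ hX hY one_ne_zero ht v w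

theorem sliceInfo_affineImage (hX : Measurable X) (hY : Measurable Y) {m n : ℕ}
    (A : Matrix (Fin m) (Fin dx) ℝ) (B : Matrix (Fin n) (Fin dy) ℝ)
    (a : EuclideanSpace ℝ (Fin m)) (b : EuclideanSpace ℝ (Fin n))
    (θ : UnitSphere m) (φ : UnitSphere n) :
    sliceInfo μ (affineImage A a X) (affineImage B b Y) θ φ =
      projInfo μ X Y (LinearMap.adjoint (Matrix.toEuclideanLin A) θ)
        (LinearMap.adjoint (Matrix.toEuclideanLin B) φ) := by
  have h := mutualInfo_affine μ
    (U := fun ω => ⟪LinearMap.adjoint (Matrix.toEuclideanLin A) θ.1, X ω⟫)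
    (V := fun ω => ⟪LinearMap.adjoint (Matrix.toEuclideanLin B) φ.1, Y ω⟫)
    (by fun_prop) (by fun_prop) one_ne_zero one_ne_zero ⟪θ.1, a⟫ ⟪φ.1, b⟫
  unfold projInfo
  rw [← h]
  simp only [sliceInfo, affineImage, inner_add_right, one_mul, LinearMap.adjoint_inner_left]

/-- Sliced mutual information of affine images as a Gaussian mean. The shifts disappear because
mutual information is translation invariant. -/
theorem slicedMI_affineImage (hX : Measurable X) (hY : Measurable Y) {m n : ℕ} (hm : 1 ≤ m)
    (hn : 1 ≤ n) (A : Matrix (Fin m) (Fin dx) ℝ) (B : Matrix (Fin n) (Fin dy) ℝ)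
    (a : EuclideanSpace ℝ (Fin m)) (b : EuclideanSpace ℝ (Fin n)) :
    slicedMI μ (affineImage A a X) (affineImage B b Y) =
      gaussianMI μ X Y (LinearMap.adjoint (Matrix.toEuclideanLin A))
        (LinearMap.adjoint (Matrix.toEuclideanLin B)) := by
  set L := LinearMap.adjoint (Matrix.toEuclideanLin A)
  set K := LinearMap.adjoint (Matrix.toEuclideanLin B)
  have hl : ∀ h, IsDirectional fun g => projInfo μ X Y (L g) (K h) := fun h t ht g => by
    dsimp only
    rw [map_smul]
    exact isDirectional_projInfo_left μ hX hY (K h) t ht (L g)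
  have hr : ∀ g, IsDirectional fun h => projInfo μ X Y (L g) (K h) := fun g t ht h => by
    dsimp only
    rw [map_smul]
    exact isDirectional_projInfo_right μ hX hY (L g) t ht (K h)
  have h := lintegral_surfaceMeasure_prod (f := fun g h => projInfo μ X Y (L g) (K h)) hm hn
    (measurable_projInfo_linear μ hX hY L K) hl hr
  rw [gaussianMI, ← h, slicedMI]
  refine congrArg _ (lintegral_congr fun θ => lintegral_congr fun φ => ?_)
  exact sliceInfo_affineImage μ hX hY A B a b θ φ

theorem slicedMI_linImage (hX : Measurable X) (hY : Measurable Y) {m n : ℕ} (hm : 1 ≤ m)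
    (hn : 1 ≤ n) (A : Matrix (Fin m) (Fin dx) ℝ) (B : Matrix (Fin n) (Fin dy) ℝ) :
    slicedMI μ (linImage A X) (linImage B Y) =
      gaussianMI μ X Y (LinearMap.adjoint (Matrix.toEuclideanLin A))
        (LinearMap.adjoint (Matrix.toEuclideanLin B)) := by
  rw [← slicedMI_affineImage μ hX hY hm hn A B 0 0]
  congr 1 <;> ext1 ω <;> simp [linImage, affineImage]

theorem projInfo_le_iSup_sliceInfo (hX : Measurable X) (hY : Measurable Y)
    (v : EuclideanSpace ℝ (Fin dx)) (w : EuclideanSpace ℝ (Fin dy)) :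
    projInfo μ X Y v w ≤ ⨆ (θ : UnitSphere dx) (φ : UnitSphere dy), sliceInfo μ X Y θ φ := by
  rcases eq_or_ne v 0 with rfl | hv
  · simp [projInfo_zero_left μ hY]
  rcases eq_or_ne w 0 with rfl | hw
  · simp [projInfo_zero_right μ hX]
  have hv' : ‖v‖ ≠ 0 := by simpa using hv
  have hw' : ‖w‖ ≠ 0 := by simpa using hw
  rw [← projInfo_smul μ hX hY (inv_ne_zero hv') (inv_ne_zero hw') v w]
  exact le_iSup₂_of_le (f := fun (θ : UnitSphere dx) (φ : UnitSphere dy) => sliceInfo μ X Y θ φ)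
    ⟨‖v‖⁻¹ • v, by simp [norm_smul, hv']⟩ ⟨‖w‖⁻¹ • w, by simp [norm_smul, hw']⟩ le_rfl

theorem gaussianMI_le_iSup_sliceInfo (hX : Measurable X) (hY : Measurable Y) {m n : ℕ}
    (L : EuclideanSpace ℝ (Fin m) →ₗ[ℝ] EuclideanSpace ℝ (Fin dx))
    (K : EuclideanSpace ℝ (Fin n) →ₗ[ℝ] EuclideanSpace ℝ (Fin dy)) :
    gaussianMI μ X Y L K ≤ ⨆ (θ : UnitSphere dx) (φ : UnitSphere dy), sliceInfo μ X Y θ φ := by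
  unfold gaussianMI
  refine (lintegral_mono fun g => lintegral_mono fun h =>
    projInfo_le_iSup_sliceInfo μ hX hY (L g) (K h)).trans ?_
  simp

theorem adjoint_firstRowMatrix {m : ℕ} (hm : 1 ≤ m) {d : ℕ} (θ : EuclideanSpace ℝ (Fin d))
    (g : EuclideanSpace ℝ (Fin m)) :
    LinearMap.adjoint (Matrix.toEuclideanLin (firstRowMatrix m θ)) g = g ⟨0, hm⟩ • θ := by
  refine ext_inner_right ℝ fun x => ?_
  rw [LinearMap.adjoint_inner_left, real_inner_smul_left, PiLp.inner_apply,
    Finset.sum_eq_single ⟨0, hm⟩]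
  · simp [firstRowMatrix, Matrix.toLpLin_apply, Matrix.mulVec, dotProduct, PiLp.inner_apply,
      mul_comm]
  · intro i _ hi
    have : (i : ℕ) ≠ 0 := fun h => hi (Fin.ext h)
    simp [firstRowMatrix, Matrix.toLpLin_apply, Matrix.mulVec, dotProduct, this]
  · simp

theorem ae_apply_ne_zero_stdGaussian {m : ℕ} (i : Fin m) :
    ∀ᵐ g ∂stdGaussian (EuclideanSpace ℝ (Fin m)), g i ≠ 0 := by
  have h := map_inner_stdGaussian (a := EuclideanSpace.single i (1 : ℝ)) (by simp)
  have := nullSingletonClass_gaussianReal (μ := 0) (v := 1) one_ne_zero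
  have h2 : ∀ᵐ t ∂gaussianReal 0 1, t ≠ (0 : ℝ) := by
    rw [ae_iff]; simp
  rw [← h] at h2
  have h3 := ae_of_ae_map (by fun_prop) h2
  filter_upwards [h3] with g hg
  rwa [EuclideanSpace.inner_single_left, map_one, one_mul] at hg

theorem slicedMI_firstRowMatrix (hX : Measurable X) (hY : Measurable Y) {m n : ℕ} (hm : 1 ≤ m)
    (hn : 1 ≤ n) (θ : UnitSphere dx) (φ : UnitSphere dy) :
    slicedMI μ (linImage (firstRowMatrix m θ.1) X) (linImage (firstRowMatrix n φ.1) Y) =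
      sliceInfo μ X Y θ φ := by
  rw [slicedMI_linImage μ hX hY hm hn, gaussianMI]
  simp_rw [adjoint_firstRowMatrix hm, adjoint_firstRowMatrix hn]
  have h : ∀ᵐ g ∂stdGaussian (EuclideanSpace ℝ (Fin m)),
      ∫⁻ h, projInfo μ X Y (g ⟨0, hm⟩ • θ.1) (h ⟨0, hn⟩ • φ.1)
        ∂stdGaussian (EuclideanSpace ℝ (Fin n)) = sliceInfo μ X Y θ φ := by
    filter_upwards [ae_apply_ne_zero_stdGaussian ⟨0, hm⟩] with g hg
    have h2 : ∀ᵐ h ∂stdGaussian (EuclideanSpace ℝ (Fin n)),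
        projInfo μ X Y (g ⟨0, hm⟩ • θ.1) (h ⟨0, hn⟩ • φ.1) = sliceInfo μ X Y θ φ := by
      filter_upwards [ae_apply_ne_zero_stdGaussian ⟨0, hn⟩] with h hh
      exact projInfo_smul μ hX hY hg hh _ _
    rw [lintegral_congr_ae h2]
    simp
  rw [lintegral_congr_ae h]
  simp

theorem gaussianMI_comp_adjoint (hX : Measurable X) (hY : Measurable Y) {m n m' n' : ℕ}
    (L : EuclideanSpace ℝ (Fin m) →ₗ[ℝ] EuclideanSpace ℝ (Fin dx))
    (K : EuclideanSpace ℝ (Fin n) →ₗ[ℝ] EuclideanSpace ℝ (Fin dy))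
    (W : EuclideanSpace ℝ (Fin m) →ₗᵢ[ℝ] EuclideanSpace ℝ (Fin m'))
    (Z : EuclideanSpace ℝ (Fin n) →ₗᵢ[ℝ] EuclideanSpace ℝ (Fin n')) :
    gaussianMI μ X Y (L ∘ₗ LinearMap.adjoint W.toLinearMap) (K ∘ₗ LinearMap.adjoint Z.toLinearMap) =
      gaussianMI μ X Y L K := by
  exact lintegral_stdGaussian_comp_adjoint (f := fun g h => projInfo μ X Y (L g) (K h))
    (measurable_projInfo_linear μ hX hY L K) W Z

theorem slicedMI_padRows (hX : Measurable X) (hY : Measurable Y) {m n r s : ℕ} (hr : 1 ≤ r)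
    (hs : 1 ≤ s) (hrm : r ≤ m) (hsn : s ≤ n) (A : Matrix (Fin r) (Fin dx) ℝ)
    (B : Matrix (Fin s) (Fin dy) ℝ) :
    slicedMI μ (linImage (padRows m A) X) (linImage (padRows n B) Y) =
      slicedMI μ (linImage A X) (linImage B Y) := by
  obtain ⟨W, hW⟩ := exists_zeroExtension hrm
  obtain ⟨Z, hZ⟩ := exists_zeroExtension hsn
  rw [slicedMI_linImage μ hX hY (hr.trans hrm) (hs.trans hsn), slicedMI_linImage μ hX hY hr hs,
    toEuclideanLin_padRows A hW, toEuclideanLin_padRows B hZ, LinearMap.adjoint_comp,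
    LinearMap.adjoint_comp, gaussianMI_comp_adjoint μ hX hY]

theorem padRows_mem_singularClass {m d r : ℕ} {c : ℝ} (hrm : r ≤ m)
    {B : Matrix (Fin r) (Fin d) ℝ} (hB : B ∈ singularClass r d r c) :
    padRows m B ∈ singularClass m d r c := by
  intro i hi
  rw [singularValues_padRows hrm]
  exact hB i hi

theorem exists_mem_singularClass_adjoint {r d : ℕ} {c : ℝ} (hc : 0 < c)
    {L : EuclideanSpace ℝ (Fin r) →ₗ[ℝ] EuclideanSpace ℝ (Fin d)}
    (hLa : ∀ x, 1 / c * ‖x‖ ≤ ‖L x‖) (hLb : ∀ x, ‖L x‖ ≤ c * ‖x‖) :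
    ∃ B ∈ singularClass r d r c, LinearMap.adjoint (Matrix.toEuclideanLin B) = L := by
  refine ⟨Matrix.toEuclideanLin.symm (LinearMap.adjoint L), fun i hi => ?_, ?_⟩
  · rw [LinearEquiv.apply_symm_apply]
    exact singularValues_adjoint_mem (by positivity) hLa hLb (by simpa using hi)
  · rw [LinearEquiv.apply_symm_apply, LinearMap.adjoint_adjoint]

/-- The mean attached to a square matrix of the class is bounded by those of the `r × d` matrices
of the class. -/
theorem lintegral_adjoint_singularClass_le {d r : ℕ} {c : ℝ} (hr : 1 ≤ r) (hrd : r ≤ d)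
    (hc : 0 < c) {A : Matrix (Fin d) (Fin d) ℝ} (hA : A ∈ singularClass d d r c)
    {F : EuclideanSpace ℝ (Fin d) → ℝ≥0∞} (hF : Measurable F) (hd : IsDirectional F) {M : ℝ≥0∞}
    (hM : ∀ B ∈ singularClass r d r c, ∫⁻ x, F (LinearMap.adjoint (Matrix.toEuclideanLin B) x)
      ∂stdGaussian (EuclideanSpace ℝ (Fin r)) ≤ M) :
    ∫⁻ x, F (LinearMap.adjoint (Matrix.toEuclideanLin A) x)
      ∂stdGaussian (EuclideanSpace ℝ (Fin d)) ≤ M := by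
  obtain ⟨S, hS, hSa⟩ := exists_subspace_le_norm_adjoint (T := Matrix.toEuclideanLin A)
    (a := 1 / c) (r := r) (by simpa using hrd) (by positivity) (fun i hi => (hA i hi).1)
  refine lintegral_stdGaussian_linear_le hF hd hr (a := 1 / c) (b := c) (by positivity)
    (fun L hLa hLb => ?_)
    hrd _ (norm_adjoint_apply_le fun i => ?_) S hS.ge hSa
  · obtain ⟨B, hB, rfl⟩ := exists_mem_singularClass_adjoint hc hLa hLb
    exact hM B hB
  · exact ((Matrix.toEuclideanLin A).singularValues_antitone (Nat.zero_le i)).trans (hA 0 hr).2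

/-- The reduction to `r` rows is carried out for one of the two matrices while the other is
fixed, first for `A` and then, after exchanging the integrals, for `B`. -/
theorem slicedMI_singularClass_le (hX : Measurable X) (hY : Measurable Y) {rx ry : ℕ}
    (hrx : 1 ≤ rx) (hrx' : rx ≤ dx) (hry : 1 ≤ ry) (hry' : ry ≤ dy) {cx cy : ℝ} (hcx : 0 < cx)
    (hcy : 0 < cy) {A : Matrix (Fin dx) (Fin dx) ℝ} (hA : A ∈ singularClass dx dx rx cx)
    {B : Matrix (Fin dy) (Fin dy) ℝ} (hB : B ∈ singularClass dy dy ry cy) {M : ℝ≥0∞}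
    (hM : ∀ A' ∈ singularClass rx dx rx cx, ∀ B' ∈ singularClass ry dy ry cy,
      slicedMI μ (linImage A' X) (linImage B' Y) ≤ M) :
    slicedMI μ (linImage A X) (linImage B Y) ≤ M := by
  rw [slicedMI_linImage μ hX hY (hrx.trans hrx') (hry.trans hry'), gaussianMI]
  have hK : Measurable fun p : EuclideanSpace ℝ (Fin dx) × EuclideanSpace ℝ (Fin dy) =>
      projInfo μ X Y p.1 (LinearMap.adjoint (Matrix.toEuclideanLin B) p.2) :=
    measurable_projInfo_linear μ hX hY LinearMap.id _
  refine lintegral_adjoint_singularClass_le hrx hrx' hcx hA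
    (F := fun v => ∫⁻ h, projInfo μ X Y v (LinearMap.adjoint (Matrix.toEuclideanLin B) h)
      ∂stdGaussian (EuclideanSpace ℝ (Fin dy))) hK.lintegral_prod_right'
    (fun t ht v => lintegral_congr fun h => isDirectional_projInfo_left μ hX hY _ t ht v)
    fun A' hA' => ?_
  have hL := fun (k : ℕ) (K : EuclideanSpace ℝ (Fin k) →ₗ[ℝ] EuclideanSpace ℝ (Fin dy)) =>
    lintegral_lintegral_swap (μ := stdGaussian (EuclideanSpace ℝ (Fin rx)))
      (ν := stdGaussian (EuclideanSpace ℝ (Fin k)))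
      (f := fun g h => projInfo μ X Y (LinearMap.adjoint (Matrix.toEuclideanLin A') g) (K h))
      (measurable_projInfo_linear μ hX hY _ K).aemeasurable
  rw [hL]
  refine lintegral_adjoint_singularClass_le hry hry' hcy hB
    (F := fun w => ∫⁻ g, projInfo μ X Y (LinearMap.adjoint (Matrix.toEuclideanLin A') g) w
      ∂stdGaussian (EuclideanSpace ℝ (Fin rx)))
    (measurable_projInfo_linear μ hX hY _ LinearMap.id).lintegral_prod_left'
    (fun t ht w => lintegral_congr fun g => isDirectional_projInfo_right μ hX hY _ t ht w)
    fun B' hB' => ?_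
  rw [← hL]
  have := hM A' hA' B' hB'
  rwa [slicedMI_linImage μ hX hY hrx hry] at this

end SlicedInformation

/-! ### The suprema -/

theorem proposition4 {Ω : Type*} [MeasurableSpace Ω] (μ : Measure Ω) [IsProbabilityMeasure μ]
    {dx dy : ℕ} (hdx : 1 ≤ dx) (hdy : 1 ≤ dy)
    (X : Ω → EuclideanSpace ℝ (Fin dx)) (Y : Ω → EuclideanSpace ℝ (Fin dy))
    (hX : Measurable X) (hY : Measurable Y) :
    -- arbitrary linear processing, into any (positive) dimensions
    (∀ mx my : ℕ, 1 ≤ mx → 1 ≤ my →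
      (⨆ (Ax : Matrix (Fin mx) (Fin dx) ℝ) (Ay : Matrix (Fin my) (Fin dy) ℝ)
          (bx : EuclideanSpace ℝ (Fin mx)) (bY : EuclideanSpace ℝ (Fin my)),
          slicedMI μ (affineImage Ax bx X) (affineImage Ay bY Y)) =
        (⨆ (Ax : Matrix (Fin mx) (Fin dx) ℝ) (Ay : Matrix (Fin my) (Fin dy) ℝ),
          slicedMI μ (linImage Ax X) (linImage Ay Y)) ∧
      (⨆ (Ax : Matrix (Fin mx) (Fin dx) ℝ) (Ay : Matrix (Fin my) (Fin dy) ℝ),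
          slicedMI μ (linImage Ax X) (linImage Ay Y)) =
        (⨆ (θ : UnitSphere dx) (φ : UnitSphere dy), sliceInfo μ X Y θ φ) ∧
      ∀ (θ : UnitSphere dx) (φ : UnitSphere dy),
        (∀ (θ' : UnitSphere dx) (φ' : UnitSphere dy),
          sliceInfo μ X Y θ' φ' ≤ sliceInfo μ X Y θ φ) →
        slicedMI μ (linImage (firstRowMatrix mx (θ : EuclideanSpace ℝ (Fin dx))) X)
            (linImage (firstRowMatrix my (φ : EuclideanSpace ℝ (Fin dy))) Y) =
          ⨆ (Ax : Matrix (Fin mx) (Fin dx) ℝ) (Ay : Matrix (Fin my) (Fin dy) ℝ)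
            (bx : EuclideanSpace ℝ (Fin mx)) (bY : EuclideanSpace ℝ (Fin my)),
            slicedMI μ (affineImage Ax bx X) (affineImage Ay bY Y)) ∧
    -- rank constrained linear processing
    (∀ rx ry : ℕ, 1 ≤ rx → rx ≤ dx → 1 ≤ ry → ry ≤ dy → ∀ cx cy : ℝ, 0 < cx → 0 < cy →
      (⨆ Ax ∈ singularClass dx dx rx cx, ⨆ Ay ∈ singularClass dy dy ry cy,
          slicedMI μ (linImage Ax X) (linImage Ay Y)) =
        (⨆ Bx ∈ singularClass rx dx rx cx, ⨆ By ∈ singularClass ry dy ry cy,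
          slicedMI μ (linImage Bx X) (linImage By Y)) ∧
      ∀ Bx ∈ singularClass rx dx rx cx, ∀ By ∈ singularClass ry dy ry cy,
        (∀ Bx' ∈ singularClass rx dx rx cx, ∀ By' ∈ singularClass ry dy ry cy,
          slicedMI μ (linImage Bx' X) (linImage By' Y) ≤
            slicedMI μ (linImage Bx X) (linImage By Y)) →
        LinearIndependent ℝ Bx.row ∧ LinearIndependent ℝ By.row ∧
        padRows dx Bx ∈ singularClass dx dx rx cx ∧
        padRows dy By ∈ singularClass dy dy ry cy ∧
        slicedMI μ (linImage (padRows dx Bx) X) (linImage (padRows dy By) Y) =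
          ⨆ Ax ∈ singularClass dx dx rx cx, ⨆ Ay ∈ singularClass dy dy ry cy,
            slicedMI μ (linImage Ax X) (linImage Ay Y)) := by
  refine ⟨fun mx my hmx hmy => ?_, fun rx ry hrx hrx' hry hry' cx cy hcx hcy => ?_⟩
  · set P := ⨆ (θ : UnitSphere dx) (φ : UnitSphere dy), sliceInfo μ X Y θ φ with hP
    set SL := ⨆ (Ax : Matrix (Fin mx) (Fin dx) ℝ) (Ay : Matrix (Fin my) (Fin dy) ℝ),
      slicedMI μ (linImage Ax X) (linImage Ay Y) with hSL
    set SA := ⨆ (Ax : Matrix (Fin mx) (Fin dx) ℝ) (Ay : Matrix (Fin my) (Fin dy) ℝ)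
      (bx : EuclideanSpace ℝ (Fin mx)) (bY : EuclideanSpace ℝ (Fin my)),
      slicedMI μ (affineImage Ax bx X) (affineImage Ay bY Y) with hSA
    have h1 : SA ≤ SL := iSup_le fun Ax => iSup_le fun Ay => iSup_le fun bx => iSup_le fun bY => by
      rw [slicedMI_affineImage μ hX hY hmx hmy, ← slicedMI_linImage μ hX hY hmx hmy]
      exact le_iSup₂ (f := fun (Ax : Matrix (Fin mx) (Fin dx) ℝ)
        (Ay : Matrix (Fin my) (Fin dy) ℝ) => slicedMI μ (linImage Ax X) (linImage Ay Y)) Ax Ay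
    have h2 : SL ≤ P := iSup₂_le fun Ax Ay => by
      rw [slicedMI_linImage μ hX hY hmx hmy]
      exact gaussianMI_le_iSup_sliceInfo μ hX hY _ _
    have h3 : SL ≤ SA := iSup₂_le fun Ax Ay => by
      rw [slicedMI_linImage μ hX hY hmx hmy, ← slicedMI_affineImage μ hX hY hmx hmy Ax Ay 0 0]
      exact le_iSup_of_le Ax (le_iSup_of_le Ay (le_iSup_of_le 0 (le_iSup_of_le 0 le_rfl)))
    have h4 : P ≤ SL := iSup₂_le fun θ φ => by
      rw [← slicedMI_firstRowMatrix μ hX hY hmx hmy θ φ]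
      exact le_iSup_of_le _ (le_iSup_of_le _ le_rfl)
    refine ⟨le_antisymm h1 h3, le_antisymm h2 h4, fun θ φ hmax => ?_⟩
    rw [slicedMI_firstRowMatrix μ hX hY hmx hmy]
    refine le_antisymm ?_ ((h1.trans h2).trans (iSup₂_le hmax))
    exact (le_iSup₂ (f := fun (θ : UnitSphere dx) (φ : UnitSphere dy) => sliceInfo μ X Y θ φ)
      θ φ).trans (h4.trans h3)
  · set SA := ⨆ Ax ∈ singularClass dx dx rx cx, ⨆ Ay ∈ singularClass dy dy ry cy,
      slicedMI μ (linImage Ax X) (linImage Ay Y)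
    set SB := ⨆ Bx ∈ singularClass rx dx rx cx, ⨆ By ∈ singularClass ry dy ry cy,
      slicedMI μ (linImage Bx X) (linImage By Y)
    have hAB : SA ≤ SB := iSup₂_le fun Ax hAx => iSup₂_le fun Ay hAy =>
      slicedMI_singularClass_le μ hX hY hrx hrx' hry hry' hcx hcy hAx hAy fun Bx hBx By hBy =>
        le_iSup₂_of_le Bx hBx (le_iSup₂_of_le By hBy le_rfl)
    have hBA : SB ≤ SA := iSup₂_le fun Bx hBx => iSup₂_le fun By hBy => by
      rw [← slicedMI_padRows μ hX hY hrx hry hrx' hry']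
      exact le_iSup₂_of_le _ (padRows_mem_singularClass hrx' hBx)
        (le_iSup₂_of_le _ (padRows_mem_singularClass hry' hBy) le_rfl)
    refine ⟨le_antisymm hAB hBA, fun Bx hBx By hBy hmax => ?_⟩
    refine ⟨linearIndependent_row_of_mem_singularClass hrx hcx hBx,
      linearIndependent_row_of_mem_singularClass hry hcy hBy,
      padRows_mem_singularClass hrx' hBx, padRows_mem_singularClass hry' hBy, ?_⟩
    rw [slicedMI_padRows μ hX hY hrx hry hrx' hry']
    refine le_antisymm ?_ (hAB.trans (iSup₂_le fun Bx' hBx' => iSup₂_le fun By' hBy' =>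
      hmax Bx' hBx' By' hBy'))
    have hle : slicedMI μ (linImage Bx X) (linImage By Y) ≤ SB :=
      le_iSup₂_of_le Bx hBx (le_iSup₂_of_le By hBy le_rfl)
    exact hle.trans hBA
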